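/- Let $V_n=\mathbb F_2^n$. For a Boolean function $f\colon V_n\to\mathbb F_2$ put $\hat f(\lambda)=\sum_{x\in V_n}(-1)^{f(x)+\langle\lambda,x\rangle}$, $\lambda\in V_n$; the family $(\hat f(\lambda))_{\lambda\in V_n}$ is the spectral sequence of $f$. Let $\mathcal A_n$ be the set of affine functions $x\mapsto\langle\alpha,x\rangle+\gamma$, and let $\mathcal Q_n$ be the set of functions $q$ such that $\hat q$ has exactly $4$ nonzero values. A bent square is an integer $2^n\times 2^n$ matrix, with rows and columns indexed by $V_n$, all of whose lines (rows and columns) are spectral sequences of Boolean functions of $n$ variables. Let $\mathcal B_n^{(AQ,k)}$ be the set of bent squares all of whose lines are spectral sequences of functions from $\mathcal A_n\cup\mathcal Q_n$ and in which exactly $k$ rows are spectral sequences of functions from $\mathcal Q_n$. Let $2\le d\le 2^{n-1}$. Consider the matrices $F$, with rows and columns indexed by $V_n$, that the following algorithm can output. (1) Choose pairwise disjoint $2$-element sets $\mathcal I_1,\dots,\mathcal I_d\subset V_n$ with $\sum_{\alpha\in\mathcal I_1}\alpha=\dots=\sum_{\alpha\in\mathcal I_d}\alpha$, and pairwise disjoint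 $2$-element sets $\mathcal J_1,\dots,\mathcal J_d\subset V_n$ with $\sum_{\beta\in\mathcal J_1}\beta=\dots=\sum_{\beta\in\mathcal J_d}\beta$; put $\mathcal I=\bigcup_i\mathcal I_i$, $\mathcal J=\bigcup_j\mathcal J_j$. (2) Choose a $0$-$1$ matrix $T=(t_{ij})$ of order $d$ with exactly two ones in each line. Let the block of $F$ with rows $\mathcal I_i$ and columns $\mathcal J_j$ have all its entries equal to $\pm2^{n-1}$ if $t_{ij}=1$ and be zero if $t_{ij}=0$, with the signs placed so that the product of the nonzero elements in each line of $2^{1-n}F[\mathcal I\mid\mathcal J]$ equals $-1$, where $F[\mathcal I\mid\mathcal J]$ is the submatrix with rows $\mathcal I$ and columns $\mathcal J$. (3) Choose the submatrix obtained by removing the rows $\mathcal I$ and the columns $\mathcal J$ so that each of its lines contains exactly one nonzero element, equal to $\pm2^n$. (4) Set all the remaining entries of $F$ to $0$. Then every matrix output by the algorithm belongs to $\mathcal B_n^{(AQ,2d)}$, and the number of distinct output matrices is exactly $$\left(\left(\frac{(2^n-1)(2^{n-1})!}{(2^{n-1}-d)!}\right)^2\cdot 2^{4d}\cdot\sum_{i=0}^d\frac{(-1)^i}{i!}-\delta_n(d)\right)\cdot(2^n-2d)!\cdot2^{2^n-2d},$$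 where, for even $d$, $$\delta_n(d)=(d/2)!\cdot2^{9d/2}\cdot\left(\tfrac43 s_n(d)r_n(d)-\tfrac49 r_n^2(d)\right),$$ $$s_n(d)=(2^n-1)\frac{(2^{n-1})!}{2^{d/2}(2^{n-1}-d)!\,(d/2)!},\qquad r_n(d)=(2^n-1)(2^{n-1}-1)\binom{2^{n-2}}{d/2},$$ and $\delta_n(d)=0$ for odd $d$. In particular, $|\mathcal B_n^{(AQ,2d)}|$ is at least this number. -/

import Mathlib

open scoped Nat

namespace BentSquares

/-- The vector space `V_n` over the field with two elements. -/
abbrev V (n : ℕ) : Type := Fin n → ZMod 2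

/-- Boolean functions of `n` variables. -/
abbrev BoolFun (n : ℕ) : Type := V n → ZMod 2

/-- The sign `(-1)^a` of `a ∈ {0, 1}`. -/
def sgn (a : ZMod 2) : ℤ := (-1) ^ a.val

/-- The inner product `a₁ x₁ + ⋯ + aₙ xₙ` over the field with two elements. -/
def ip {n : ℕ} (a x : V n) : ZMod 2 := ∑ i, a i * x i

/-- The Walsh--Hadamard transform (the spectral sequence) of `f`. -/
def walsh {n : ℕ} (f : BoolFun n) (a : V n) : ℤ :=
  ∑ x : V n, sgn (f x) * sgn (ip a x)

/-- The set of affine functions of `n` variables. -/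
def affineFuns (n : ℕ) : Set (BoolFun n) :=
  {l | ∃ (a : V n) (c : ZMod 2), ∀ x, l x = ip a x + c}

/-- The set of functions of `n` variables with exactly four nonzero Walsh coefficients. -/
def quadFuns (n : ℕ) : Set (BoolFun n) :=
  {q | (Finset.univ.filter fun a : V n => walsh q a ≠ 0).card = 4}

/-- Bent squares: integer matrices of order `2^n`, rows and columns indexed by `V n`,
all of whose rows and columns are spectral sequences. -/
def bentSquares (n : ℕ) : Set (Matrix (V n) (V n) ℤ) :=
  {F | (∀ a, ∃ f : BoolFun n, F a = walsh f) ∧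
       (∀ b, ∃ f : BoolFun n, (fun a => F a b) = walsh f)}

/-- Bent squares all of whose rows and columns are spectral sequences of functions that are
affine or have exactly four nonzero Walsh coefficients. -/
def bentSquaresAQ (n : ℕ) : Set (Matrix (V n) (V n) ℤ) :=
  {F | F ∈ bentSquares n ∧
       (∀ a, ∃ f ∈ affineFuns n ∪ quadFuns n, F a = walsh f) ∧
       (∀ b, ∃ f ∈ affineFuns n ∪ quadFuns n, (fun a => F a b) = walsh f)}

/-- The set of (indices of) rows of `F` that are spectral sequences of functions with exactly
four nonzero Walsh coefficients. -/
def quadRows {n : ℕ} (F : Matrix (V n) (V n) ℤ) : Set (V n) :=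
  {a | ∃ q ∈ quadFuns n, F a = walsh q}

/-- The elements of `bentSquaresAQ n` with exactly `k` rows that are spectral sequences of
functions with exactly four nonzero Walsh coefficients. -/
def bentSquaresAQCount (n k : ℕ) : Set (Matrix (V n) (V n) ℤ) :=
  {F | F ∈ bentSquaresAQ n ∧ (quadRows F).ncard = k}

/-- Step 1 of the algorithm, for the rows or for the columns:
disjoint two-element subsets of `V n` with the same sum of elements. -/
def IsPairFamily {n d : ℕ} (I : Fin d → Finset (V n)) : Prop :=
  (∀ i, (I i).card = 2) ∧
  (∀ i j, i ≠ j → Disjoint (I i) (I j)) ∧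
  (∀ i j, ∑ a ∈ I i, a = ∑ a ∈ I j, a)

/-- The union of the members of a family. -/
def union {n d : ℕ} (I : Fin d → Finset (V n)) : Finset (V n) :=
  Finset.univ.biUnion I

/-- A `0`-`1` matrix of order `d` with exactly two ones in each line. -/
def IsTwoRegular {d : ℕ} (T : Matrix (Fin d) (Fin d) ℕ) : Prop :=
  (∀ i j, T i j = 0 ∨ T i j = 1) ∧
  (∀ i, (Finset.univ.filter fun j => T i j = 1).card = 2) ∧
  (∀ j, (Finset.univ.filter fun i => T i j = 1).card = 2)

/-- Step 2 of the algorithm: `M` is the sign pattern on the rows in `union I` and the columns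
in `union J`, so that the submatrix of the output is `2^(n-1)` times `M`.
The block on `I i`, `J j` has entries `±1` if `T i j = 1` and is zero if `T i j = 0`,
and the product of the nonzero elements in each line is `-1`. -/
def IsSignPattern {n d : ℕ} (I J : Fin d → Finset (V n)) (T : Matrix (Fin d) (Fin d) ℕ)
    (M : Matrix (V n) (V n) ℤ) : Prop :=
  (∀ i j, ∀ a ∈ I i, ∀ b ∈ J j,
    (T i j = 1 → M a b = 1 ∨ M a b = -1) ∧ (T i j = 0 → M a b = 0)) ∧
  (∀ a ∈ union I, ∏ b ∈ (union J).filter (fun b => M a b ≠ 0), M a b = -1) ∧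
  (∀ b ∈ union J, ∏ a ∈ (union I).filter (fun a => M a b ≠ 0), M a b = -1)

/-- Step 3 of the algorithm: in the submatrix of `F` obtained by removing the rows in `R` and
the columns in `C`, each line contains exactly one nonzero element, equal to `±2^n`. -/
def IsMonomialOutside {n : ℕ} (R C : Finset (V n)) (F : Matrix (V n) (V n) ℤ) : Prop :=
  (∀ a ∉ R, ∀ b ∉ C, F a b = 0 ∨ F a b = 2 ^ n ∨ F a b = -2 ^ n) ∧
  (∀ a ∉ R, ∃! b, b ∉ C ∧ F a b ≠ 0) ∧
  (∀ b ∉ C, ∃! a, a ∉ R ∧ F a b ≠ 0)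

/-- The set of all matrices that the algorithm can output,
over all choices made in its steps. -/
def algorithmOutputs (n d : ℕ) : Set (Matrix (V n) (V n) ℤ) :=
  {F | ∃ (I J : Fin d → Finset (V n)) (T : Matrix (Fin d) (Fin d) ℕ)
        (M : Matrix (V n) (V n) ℤ),
      IsPairFamily I ∧ IsPairFamily J ∧ IsTwoRegular T ∧ IsSignPattern I J T M ∧
      (∀ a ∈ union I, ∀ b ∈ union J, F a b = 2 ^ (n - 1) * M a b) ∧
      IsMonomialOutside (union I) (union J) F ∧
      (∀ a b, (a ∈ union I ∧ b ∉ union J) ∨ (a ∉ union I ∧ b ∈ union J) → F a b = 0)}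

/-- `s_n(d)`; used for even `d` with `2 ≤ d ≤ 2^(n-1)`. -/
def sNum (n d : ℕ) : ℚ :=
  (2 ^ n - 1) * (((2 ^ (n - 1))! : ℕ) /
    (2 ^ (d / 2) * ((2 ^ (n - 1) - d)! : ℕ) * ((d / 2)! : ℕ)))

/-- `r_n(d)`; used for even `d` with `2 ≤ d ≤ 2^(n-1)`, so that `n ≥ 2`. -/
def rNum (n d : ℕ) : ℚ :=
  (2 ^ n - 1) * (2 ^ (n - 1) - 1) * (((2 ^ (n - 2)).choose (d / 2) : ℕ) : ℚ)

/-- The correction term `δ_n(d)`. -/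
def delta (n d : ℕ) : ℚ :=
  if Even d then
    ((d / 2)! : ℕ) * 2 ^ (9 * (d / 2)) *
      (4 / 3 * sNum n d * rNum n d - 4 / 9 * rNum n d ^ 2)
  else 0

/-- The number of distinct bent squares. -/
def outputCount (n d : ℕ) : ℚ :=
  ((((2 ^ n - 1) * ((2 ^ (n - 1))! : ℕ) / ((2 ^ (n - 1) - d)! : ℕ)) ^ 2 * 2 ^ (4 * d) *
      ∑ i ∈ Finset.range (d + 1), (-1) ^ i / (i ! : ℚ)) - delta n d) *
    ((2 ^ n - 2 * d)! : ℕ) * 2 ^ (2 ^ n - 2 * d)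

end BentSquares

open scoped Nat

namespace BentSquares

open Finset

set_option linter.unusedSectionVars false
set_option linter.unusedSimpArgs false

/-! ### Arrays with entries `0`, `1`, `-1` -/

section Lines
variable {α β γ : Type*} [Fintype α] [Fintype β] [Fintype γ]

/-! Different choices of pairs, `T` and signs can yield the same matrix, so the count needs a
description of an output that forgets these choices. Up to scaling, an output is a pair of sign
arrays: `M` for the entries `±2^(n-1)` and a monomial array `G` for the entries `±2^n`. The possible
`M` are the core arrays: every nonzero line has four nonzero elements with product `-1`, there are
`2d` nonzero rows, and the support is invariant under some nonzero translation `s` of the rows and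
some nonzero `t` of the columns. The orbits `{a, a + s}` and `{b, b + t}` give back the pairs of
step 1. For each `M` there are `(2^n - 2d)! * 2^(2^n - 2d)` arrays `G`, so everything rests on
counting core arrays (`card_coreArrays`).

The triples `(M, s, t)` are counted first. For fixed `s` and `t`, adapted coordinates turn the
support into a union of full blocks of order two. Recording a block by its corner, one row product,
one column product and its total product makes the line conditions independent. The signs then
contribute `2^(4d)` times the number of arrays of order `2^(n-1)` with `d` nonzero rows whose
nonzero lines consist of one `1` and one `-1` (`card_blockArrays`). Such an array is an injection of
a `d`-set of rows into the columns together with a derangement, hence the alternating sum in the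
formula.

An array is thereby counted once for each pair of a row direction and a column direction. Two column
directions force every nonzero row support to be a coset of one plane, so a multiple count occurs
only if row supports are pairwise equal or disjoint (`RectClosed`). Such an array is a bijection
between two families of `k = d/2` disjoint four-element sets, with one of 512 sign patterns on each
full block of order four. Its directions depend only on the families, so sums over these arrays
factor as squares. A family has 0, 1 or 3 directions. With `S` the total number of directions of
families and `R` the number of families having a direction, `S = s_n(d)` and `R = s_n(d) - (2/3)
r_n(d)`; the excess `k! * 512^k * (S^2 - R^2)` is `δ_n(d)`.

Outputs are bent squares by Fourier inversion: the four nonzero positions of a row through `M` sum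
to zero and the product of its signs is `-1`, so the inverse transform is `±1` everywhere. -/

/-- The support of a line. -/
def supp (f : β → SignType) : Finset β := univ.filter fun b => f b ≠ 0

@[simp] theorem mem_supp {f : β → SignType} {b : β} : b ∈ supp f ↔ f b ≠ 0 := by simp [supp]

theorem supp_eq_empty {f : β → SignType} : supp f = ∅ ↔ f = 0 := by
  simp [supp, filter_eq_empty_iff, funext_iff]

/-- A line is zero, or it has exactly `k` nonzero elements and their product is `-1`. -/
def IsLine (k : ℕ) (f : β → SignType) : Prop :=
  f = 0 ∨ ((supp f).card = k ∧ ∏ b ∈ supp f, f b = -1)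

/-- All rows and columns of the array are lines with `k` nonzero elements or zero. -/
def IsSignArray (k : ℕ) (M : α → β → SignType) : Prop :=
  (∀ a, IsLine k (M a)) ∧ ∀ b, IsLine k (fun a => M a b)

/-- The set of nonzero rows. -/
def rowSet (M : α → β → SignType) : Finset α := univ.filter fun a => (supp (M a)).Nonempty

theorem mem_rowSet {M : α → β → SignType} {a : α} : a ∈ rowSet M ↔ ∃ b, M a b ≠ 0 := by
  
  rw [rowSet, mem_filter]
  simp [Finset.Nonempty]

theorem IsSignArray.transpose {k : ℕ} {M : α → β → SignType} (h : IsSignArray k M) :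
    IsSignArray k (fun b a => M a b) := ⟨h.2, h.1⟩

theorem IsLine.card_supp {k : ℕ} {f : β → SignType} (h : IsLine k f) {b : β} (hb : f b ≠ 0) :
    (supp f).card = k := by
  rcases h with h | h
  · simp [h] at hb
  · exact h.1

theorem IsLine.prod_supp {k : ℕ} {f : β → SignType} (h : IsLine k f) {b : β} (hb : f b ≠ 0) :
    ∏ b ∈ supp f, f b = -1 := by
  rcases h with h | h
  · simp [h] at hb
  · exact h.2

theorem isLine_comp_equiv {k : ℕ} {f : β → SignType} (e : γ ≃ β) :
    IsLine k (f ∘ e) ↔ IsLine k f := by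
  have h1 : (supp (f ∘ e)).map e.toEmbedding = supp f := by
    ext b
    simp only [mem_map, mem_supp, Function.comp_apply, Equiv.coe_toEmbedding]
    exact ⟨by rintro ⟨a, ha, rfl⟩; exact ha, fun h => ⟨e.symm b, by simpa using h, by simp⟩⟩
  have h0 : f ∘ e = 0 ↔ f = 0 := by
    rw [← supp_eq_empty, ← supp_eq_empty, ← h1, map_eq_empty]
  rw [IsLine, IsLine, h0, ← h1, card_map, prod_map]
  rfl

/-- The nonzero elements of an array, counted by rows. -/
theorem card_rowSet_mul {k : ℕ} {M : α → β → SignType} (h : IsSignArray k M) :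
    (rowSet M).card * k = ∑ a, ∑ b, if M a b ≠ 0 then 1 else 0 := by
  rw [← smul_eq_mul, ← sum_const]
  rw [← sum_subset (subset_univ (rowSet M))]
  · refine sum_congr rfl fun a ha => ?_
    obtain ⟨b, hb⟩ := mem_rowSet.1 ha
    rw [← (h.1 a).card_supp hb, supp, card_filter]
  · intro a _ ha
    have : ∀ b, M a b = 0 := by simpa [mem_rowSet] using ha
    simp [this]

/-- Both sides times `k` count the nonzero elements. -/
theorem card_rowSet_transpose {k : ℕ} (hk : 0 < k) {M : α → β → SignType}
    (h : IsSignArray k M) : (rowSet (fun b a => M a b)).card = (rowSet M).card := by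
  apply Nat.eq_of_mul_eq_mul_right hk
  rw [card_rowSet_mul h, card_rowSet_mul h.transpose, sum_comm]

theorem signType_eq_one_or {x : SignType} (h : x ≠ 0) : x = 1 ∨ x = -1 := by
  revert h; cases x <;> decide

/-- Two signs with product `-1` are one `1` and one `-1`, so a nonzero line is just an ordered pair
of distinct positions. -/
theorem isLine_two_iff [DecidableEq β] {f : β → SignType} :
    IsLine 2 f ↔ f = 0 ∨ ∃ b b', b ≠ b' ∧ f = fun x => if x = b then 1 else if x = b' then -1 else 0 := by
  refine or_congr_right ⟨?_, ?_⟩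
  · rintro ⟨h1, h2⟩
    obtain ⟨x, y, hxy, hs⟩ := card_eq_two.1 h1
    rw [hs, prod_pair hxy] at h2
    have hz : ∀ z, z ≠ x → z ≠ y → f z = 0 := by
      intro z hx hy
      by_contra h
      have : z ∈ supp f := by simpa using h
      rw [hs] at this
      simp [hx, hy] at this
    have : (f x = 1 ∧ f y = -1) ∨ (f y = 1 ∧ f x = -1) := by
      revert h2; generalize f x = u; generalize f y = v; cases u <;> cases v <;> decide
    rcases this with h | h
    · refine ⟨x, y, hxy, funext fun z => ?_⟩
      split_ifs with h1 h2
      · rw [h1, h.1]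
      · rw [h2, h.2]
      · exact hz z h1 h2
    · refine ⟨y, x, hxy.symm, funext fun z => ?_⟩
      split_ifs with h1 h2
      · rw [h1, h.1]
      · rw [h2, h.2]
      · exact hz z h2 h1
  · rintro ⟨b, b', hb, rfl⟩
    have hs : supp (fun x => if x = b then (1 : SignType) else if x = b' then -1 else 0) = {b, b'} := by
      ext z
      simp only [mem_supp, mem_insert, mem_singleton]
      split_ifs with h1 h2
      · simp [h1]
      · simp [h2]
      · simp [h1, h2]
    rw [hs, prod_pair hb, card_pair hb]
    simp [hb.symm]

end Lines

/-! ### Arrays whose nonzero lines consist of one `1` and one `-1` -/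

section TwoLines
variable {α β : Type*} [Fintype α] [Fintype β] [DecidableEq α] [DecidableEq β]

open Classical in
/-- The arrays with `d` nonzero rows in which each nonzero line consists of `1`, `-1` and zeros. -/
noncomputable def twoArrays (α β : Type*) [Fintype α] [Fintype β] [DecidableEq α] [DecidableEq β]
    (d : ℕ) : Finset (α → β → SignType) :=
  univ.filter fun w => IsSignArray 2 w ∧ (rowSet w).card = d

theorem mem_twoArrays {d : ℕ} {w : α → β → SignType} :
    w ∈ twoArrays α β d ↔ IsSignArray 2 w ∧ (rowSet w).card = d := by
  classical
  rw [twoArrays, mem_filter]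
  simp

/-- The array with `1` at the positions `(a, σ a)` and `-1` at the positions `(a, σ (δ a))`. -/
def pairArray (S : Finset α) (σ : S → β) (δ : Equiv.Perm S) : α → β → SignType := fun a b =>
  if h : a ∈ S then (if b = σ ⟨a, h⟩ then 1 else if b = σ (δ ⟨a, h⟩) then -1 else 0) else 0

theorem pairArray_eq_one {S : Finset α} {σ : S → β} {δ : Equiv.Perm S} {a : α} {b : β} :
    pairArray S σ δ a b = 1 ↔ ∃ h : a ∈ S, σ ⟨a, h⟩ = b := by
  unfold pairArray
  by_cases h : a ∈ S
  · simp only [h, dif_pos, exists_true_left]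
    split_ifs with h1 h2
    · simp [h1]
    · simp [Ne.symm h1]
    · simp [Ne.symm h1]
  · simp [h]

theorem pairArray_eq_neg_one {S : Finset α} {σ : S → β} {δ : Equiv.Perm S}
    (hσ : Function.Injective σ) (hδ : δ ∈ derangements S) {a : α} {b : β} :
    pairArray S σ δ a b = -1 ↔ ∃ h : a ∈ S, σ (δ ⟨a, h⟩) = b := by
  unfold pairArray
  by_cases h : a ∈ S
  · have hne : σ (δ ⟨a, h⟩) ≠ σ ⟨a, h⟩ := fun e => hδ _ (hσ e)
    simp only [h, dif_pos, exists_true_left]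
    split_ifs with h1 h2
    · simp [h1, hne]
    · simp [h2]
    · simp [Ne.symm h2]
  · simp [h]

theorem pairArray_mem {S : Finset α} {σ : S → β} {δ : Equiv.Perm S}
    (hσ : Function.Injective σ) (hδ : δ ∈ derangements S) :
    pairArray S σ δ ∈ twoArrays α β S.card := by
  rw [mem_twoArrays]
  refine ⟨⟨fun a => ?_, fun b => ?_⟩, ?_⟩
  · rw [isLine_two_iff]
    by_cases h : a ∈ S
    · refine Or.inr ⟨σ ⟨a, h⟩, σ (δ ⟨a, h⟩), fun e => hδ _ (hσ e.symm), funext fun x => ?_⟩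
      simp [pairArray, h]
    · exact Or.inl (funext fun x => by simp [pairArray, h])
  · rw [isLine_two_iff]
    by_cases h : ∃ a, σ a = b
    · obtain ⟨a, rfl⟩ := h
      -- The column `σ a` has its `1` in row `a` and its `-1` in row `δ⁻¹ a`; these rows differ
      -- because `δ` is a derangement.
      refine Or.inr ⟨a, δ.symm a, ?_, funext fun x => ?_⟩
      · intro e
        apply hδ (δ.symm a)
        rw [Equiv.apply_symm_apply]
        exact Subtype.ext e
      · have hn : δ.symm a ≠ a := fun e => hδ (δ.symm a) (by rw [Equiv.apply_symm_apply, e])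
        show pairArray S σ δ x (σ a) = _
        split_ifs with h1 h2
        · exact pairArray_eq_one.2 ⟨h1 ▸ a.2, by congr; ⟩
        · exact (pairArray_eq_neg_one hσ hδ).2 ⟨h2 ▸ (δ.symm a).2, by
            subst h2; simp⟩
        · by_contra h0
          rcases signType_eq_one_or h0 with h0 | h0
          · obtain ⟨hx, hx'⟩ := pairArray_eq_one.1 h0
            exact h1 (congrArg Subtype.val (hσ hx'))
          · obtain ⟨hx, hx'⟩ := (pairArray_eq_neg_one hσ hδ).1 h0
            exact h2 (by rw [← hσ hx']; simp)
    · refine Or.inl (funext fun x => ?_)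
      show pairArray S σ δ x b = 0
      by_contra h0
      rcases signType_eq_one_or h0 with h0 | h0
      · obtain ⟨hx, hx'⟩ := pairArray_eq_one.1 h0
        exact h ⟨_, hx'⟩
      · obtain ⟨hx, hx'⟩ := (pairArray_eq_neg_one hσ hδ).1 h0
        exact h ⟨_, hx'⟩
  · congr 1
    ext a
    rw [mem_rowSet]
    constructor
    · rintro ⟨b, hb⟩
      by_contra h
      simp [pairArray, h] at hb
    · intro h
      refine ⟨σ ⟨a, h⟩, ?_⟩
      rw [pairArray_eq_one.2 ⟨h, rfl⟩]
      decide

theorem exists_unique_of_isLine_two {f : β → SignType} (h : IsLine 2 f) {c : β} (hc : f c ≠ 0) :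
    (∃! b, f b = 1) ∧ ∃! b, f b = -1 := by
  rcases isLine_two_iff.1 h with h | ⟨x, y, hxy, rfl⟩
  · simp [h] at hc
  · refine ⟨⟨x, by simp, fun z hz => ?_⟩, ⟨y, by simp [hxy.symm], fun z hz => ?_⟩⟩
    · by_contra h
      by_cases hy : z = y <;> simp [h, hy, hxy.symm] at hz
    · by_contra h
      by_cases hy : z = x <;> simp [h, hy] at hz

/-- Let `σ` and `τ` give the columns of the `1` and the `-1` in each nonzero row. The column `τ a`
also contains a `1`, in a row `δ a`, so `τ = σ ∘ δ`. A fixed point of `δ` would put `1` and `-1` in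
one position. -/
theorem exists_eq_pairArray {w : α → β → SignType} (hw : IsSignArray 2 w) :
    ∃ (σ : rowSet w → β) (δ : Equiv.Perm (rowSet w)), Function.Injective σ ∧
      δ ∈ derangements (rowSet w) ∧ w = pairArray (rowSet w) σ δ := by
  have hrow : ∀ a : rowSet w, (∃! b, w a b = 1) ∧ ∃! b, w a b = -1 := fun a => by
    obtain ⟨b, hb⟩ := mem_rowSet.1 a.2
    exact exists_unique_of_isLine_two (hw.1 a) hb
  have hcol : ∀ b a, w a b ≠ 0 → (∃! a, w a b = 1) ∧ ∃! a, w a b = -1 := fun b a hb =>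
    exists_unique_of_isLine_two (f := fun a => w a b) (hw.2 b) hb
  have h1 : (1 : SignType) ≠ 0 := by decide
  have h2 : (-1 : SignType) ≠ 0 := by decide
  choose σ hσ using fun a => (hrow a).1
  choose τ hτ using fun a => (hrow a).2
  have hσi : Function.Injective σ := fun a a' h => by
    have e1 := (hσ a).1
    have e2 := (hσ a').1
    simp only at e1 e2
    rw [← h] at e2
    exact Subtype.ext ((hcol _ a (by rw [e1]; exact h1)).1.unique e1 e2)
  have hτi : Function.Injective τ := fun a a' h => by
    have e1 := (hτ a).1
    have e2 := (hτ a').1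
    simp only at e1 e2
    rw [← h] at e2
    exact Subtype.ext ((hcol _ a (by rw [e1]; exact h2)).2.unique e1 e2)
  have hex : ∀ a, ∃ a', σ a' = τ a := fun a => by
    have e1 := (hτ a).1
    simp only at e1
    obtain ⟨a', ha', -⟩ := (hcol (τ a) a (by rw [e1]; exact h2)).1
    have hm : a' ∈ rowSet w := mem_rowSet.2 ⟨τ a, by rw [ha']; exact h1⟩
    exact ⟨⟨a', hm⟩, ((hσ ⟨a', hm⟩).2 _ ha').symm⟩
  choose δ hδ using hex
  have hδi : Function.Injective δ := fun a a' h => hτi (by rw [← hδ, ← hδ, h])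
  refine ⟨σ, Equiv.ofBijective δ (Finite.injective_iff_bijective.1 hδi), hσi, ?_, ?_⟩
  · intro a ha
    have ha' : δ a = a := ha
    have e1 := (hσ a).1
    have e2 := (hτ a).1
    simp only at e1 e2
    rw [← hδ, ha', e1] at e2
    revert e2; decide
  · funext a b
    by_cases ha : a ∈ rowSet w
    · have e1 := hσ ⟨a, ha⟩
      have e2 := hτ ⟨a, ha⟩
      simp only [pairArray, ha, dif_pos, Equiv.ofBijective_apply, hδ]
      split_ifs with h h'
      · rw [h]; exact e1.1
      · rw [h']; exact e2.1
      · by_contra h0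
        rcases signType_eq_one_or h0 with h0 | h0
        · exact h (e1.2 _ h0)
        · exact h' (e2.2 _ h0)
    · simp only [pairArray, ha, dif_neg, not_false_eq_true]
      by_contra h
      exact ha (mem_rowSet.2 ⟨b, h⟩)

/-- For a fixed set of `d` nonzero rows the arrays correspond bijectively to pairs of an embedding
into the columns and a derangement of the rows. -/
theorem card_twoArrays (d : ℕ) :
    (twoArrays α β d).card = (Fintype.card α).choose d *
      ((Fintype.card β).descFactorial d * numDerangements d) := by
  have hfib : ∀ S ∈ powersetCard d (univ : Finset α),
      ((twoArrays α β d).filter fun w => rowSet w = S).card =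
        (Fintype.card β).descFactorial d * numDerangements d := by
    intro S hS
    have hSd : S.card = d := (mem_powersetCard.1 hS).2
    have hc : Fintype.card ((S ↪ β) × derangements S) =
        (Fintype.card β).descFactorial d * numDerangements d := by
      rw [Fintype.card_prod, Fintype.card_embedding_eq, card_derangements_eq_numDerangements,
        Fintype.card_coe, hSd]
    rw [← hc, ← card_univ]
    symm
    refine card_bij (fun p _ => pairArray S p.1 p.2.1) ?_ ?_ ?_
    · intro p _
      have hm := pairArray_mem p.1.injective p.2.2
      rw [mem_filter, ← hSd]
      refine ⟨hm, ?_⟩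
      ext a
      rw [mem_rowSet]
      constructor
      · rintro ⟨b, hb⟩
        by_contra h
        simp [pairArray, h] at hb
      · intro h
        refine ⟨p.1 ⟨a, h⟩, ?_⟩
        rw [pairArray_eq_one.2 ⟨h, rfl⟩]
        decide
    · rintro ⟨σ, δ, hδ⟩ _ ⟨σ', δ', hδ'⟩ _ h
      have hσ : ∀ a, σ a = σ' a := fun a => by
        have : pairArray S σ δ a (σ a) = 1 := pairArray_eq_one.2 ⟨a.2, rfl⟩
        simp only at h
        rw [h] at this
        obtain ⟨_, h'⟩ := pairArray_eq_one.1 this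
        exact h'.symm
      have hσ' : σ = σ' := DFunLike.ext _ _ hσ
      subst hσ'
      have hd : δ = δ' := Equiv.ext fun a => by
        have : pairArray S σ δ a (σ (δ a)) = -1 :=
          (pairArray_eq_neg_one σ.injective hδ).2 ⟨a.2, rfl⟩
        simp only at h
        rw [h] at this
        obtain ⟨_, h'⟩ := (pairArray_eq_neg_one σ.injective hδ').1 this
        exact (σ.injective h').symm
      subst hd
      rfl
    · intro w hw
      obtain ⟨hw1, rfl⟩ := mem_filter.1 hw
      obtain ⟨σ, δ, hσ, hδ, h⟩ := exists_eq_pairArray (mem_twoArrays.1 hw1).1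
      exact ⟨(⟨σ, hσ⟩, ⟨δ, hδ⟩), mem_univ _, h.symm⟩
  rw [card_eq_sum_card_fiberwise (f := rowSet) (t := powersetCard d (univ : Finset α)),
    sum_congr rfl hfib, sum_const, card_powersetCard, smul_eq_mul, card_univ]
  intro w hw
  exact mem_powersetCard.2 ⟨subset_univ _, (mem_twoArrays.1 hw).2⟩

end TwoLines

/-! ### Arrays with a prescribed support -/

section Supports
variable {α β : Type*} [Fintype α] [Fintype β] [DecidableEq α] [DecidableEq β]

/-- The column of `b` in the relation given by `T`. -/
def colOf (T : α → Finset β) (b : β) : Finset α := univ.filter fun a => b ∈ T a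

@[simp] theorem mem_colOf {T : α → Finset β} {a : α} {b : β} : a ∈ colOf T b ↔ b ∈ T a := by
  simp [colOf]

/-- The relations with `d` nonempty rows in which each nonempty line has two elements. -/
structure IsTwoRel (d : ℕ) (T : α → Finset β) : Prop where
  row : ∀ a, (T a).Nonempty → (T a).card = 2
  col : ∀ b, (colOf T b).Nonempty → (colOf T b).card = 2
  card : (univ.filter fun a => (T a).Nonempty).card = d

theorem colOf_colOf (T : α → Finset β) : colOf (colOf T) = T := by
  ext a b; simp

/-- Hall's condition: rows in `s` have two incidences each, and a column absorbs at most two. -/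
theorem card_mul_two_le {T : α → Finset β} {d : ℕ} (hT : IsTwoRel d T) (s : Finset α)
    (hs : ∀ a ∈ s, (T a).Nonempty) : s.card * 2 ≤ (s.biUnion T).card * 2 := by
  refine card_mul_le_card_mul (fun a b => b ∈ T a) (fun a ha => ?_) fun b _ => ?_
  · rw [← hT.row a (hs a ha)]
    refine card_le_card fun b hb => ?_
    rw [mem_bipartiteAbove]
    exact ⟨mem_biUnion.2 ⟨a, ha, hb⟩, hb⟩
  · by_cases h : (colOf T b).Nonempty
    · rw [← hT.col b h]
      refine card_le_card fun a ha => ?_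
      rw [mem_bipartiteBelow] at ha
      exact mem_colOf.2 ha.2
    · rw [card_eq_zero.2]
      · exact Nat.zero_le _
      · rw [eq_empty_iff_forall_notMem]
        intro a ha
        rw [mem_bipartiteBelow] at ha
        exact h ⟨a, mem_colOf.2 ha.2⟩

theorem card_nonempty_col_le {T : α → Finset β} {d : ℕ} (hT : IsTwoRel d T) :
    (univ.filter fun b => (colOf T b).Nonempty).card ≤ d := by
  have h : (univ.filter fun b => (colOf T b).Nonempty).card * 2 ≤
      (univ.filter fun a => (T a).Nonempty).card * 2 := by
    refine card_mul_le_card_mul (fun b a => b ∈ T a) (fun b hb => ?_) fun a ha => ?_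
    · have hb := (mem_filter.1 hb).2
      rw [← hT.col b hb]
      refine card_le_card fun a ha => ?_
      rw [mem_bipartiteAbove]
      rw [mem_colOf] at ha
      exact ⟨mem_filter.2 ⟨mem_univ _, b, ha⟩, ha⟩
    · have ha := (mem_filter.1 ha).2
      rw [← hT.row a ha]
      refine card_le_card fun b hb => ?_
      rw [mem_bipartiteBelow] at hb
      exact hb.2
  rw [hT.card] at h
  omega

/-- A relation with two elements in each nonempty line contains a perfect matching. -/
theorem exists_matching {T : α → Finset β} {d : ℕ} (hT : IsTwoRel d T) :
    ∃ m : α → β → Prop, (∀ a b, m a b → b ∈ T a) ∧ (∀ a, (T a).Nonempty → ∃! b, m a b) ∧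
      ∀ b, (colOf T b).Nonempty → ∃! a, m a b := by
  have hall := (Finset.all_card_le_biUnion_card_iff_exists_injective
    (fun a : {a // (T a).Nonempty} => T a)).1 (by
      intro s
      have := card_mul_two_le hT (s.map (Function.Embedding.subtype _)) (by
        intro a ha
        obtain ⟨a, -, rfl⟩ := mem_map.1 ha
        exact a.2)
      rw [card_map] at this
      have h2 : (s.map (Function.Embedding.subtype _)).biUnion T =
          s.biUnion fun a : {a // (T a).Nonempty} => T a := by
        ext b; simp
      rw [h2] at this
      omega)
  obtain ⟨f, hf, hfT⟩ := hall
  -- Hall's theorem only matches every row. Since there are at most `d` nonempty columns, the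
  -- injection `g` is a bijection and every nonempty column is matched too.
  let g : {a // (T a).Nonempty} → {b // (colOf T b).Nonempty} := fun a =>
    ⟨f a, a, mem_colOf.2 (hfT a)⟩
  have hg : Function.Injective g := fun a a' h => hf (congrArg Subtype.val h)
  have hgs : Function.Surjective g := by
    refine ((Fintype.bijective_iff_injective_and_card g).2 ⟨hg, ?_⟩).2
    apply le_antisymm (Fintype.card_le_of_injective g hg)
    rw [Fintype.card_subtype, Fintype.card_subtype, hT.card]
    exact card_nonempty_col_le hT
  refine ⟨fun a b => ∃ h : (T a).Nonempty, f ⟨a, h⟩ = b, ?_, ?_, ?_⟩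
  · rintro a b ⟨h, rfl⟩
    exact hfT _
  · intro a ha
    exact ⟨f ⟨a, ha⟩, ⟨ha, rfl⟩, by rintro b ⟨_, rfl⟩; rfl⟩
  · intro b hb
    obtain ⟨a, ha⟩ := hgs ⟨b, hb⟩
    have ha' : f a = b := congrArg Subtype.val ha
    refine ⟨a, ⟨a.2, ha'⟩, ?_⟩
    rintro a' ⟨h, h'⟩
    exact congrArg Subtype.val (hf (h'.trans ha'.symm))

/-- The arrays with support `T`. -/
def onSupp (T : α → Finset β) : Finset (α → β → SignType) :=
  univ.filter fun x => ∀ a b, x a b ≠ 0 ↔ b ∈ T a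

@[simp] theorem mem_onSupp {T : α → Finset β} {x : α → β → SignType} :
    x ∈ onSupp T ↔ ∀ a b, x a b ≠ 0 ↔ b ∈ T a := by simp [onSupp]

/-- The product of the nonzero elements in each nonzero row is `ε`. -/
def RowProd (T : α → Finset β) (ε : SignType) (x : α → β → SignType) : Prop :=
  ∀ a, (T a).Nonempty → ∏ b ∈ T a, x a b = ε

/-- The product of the nonzero elements in each nonzero column is `ε`. -/
def ColProd (T : α → Finset β) (ε : SignType) (x : α → β → SignType) : Prop :=
  ∀ b, (colOf T b).Nonempty → ∏ a ∈ colOf T b, x a b = ε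

theorem sum_card_row {T : α → Finset β} {d : ℕ} (hT : IsTwoRel d T) :
    ∑ a, (T a).card = 2 * d := by
  rw [← sum_subset (subset_univ (univ.filter fun a => (T a).Nonempty))]
  · rw [sum_congr rfl fun a ha => hT.row a (mem_filter.1 ha).2, sum_const, hT.card, smul_eq_mul,
      mul_comm]
  · intro a _ ha
    simpa using ha

theorem card_onSupp {T : α → Finset β} {d : ℕ} (hT : IsTwoRel d T) :
    (onSupp T).card = 2 ^ (2 * d) := by
  have h : onSupp T = Fintype.piFinset fun a => Fintype.piFinset fun b =>
      (if b ∈ T a then {1, -1} else {0} : Finset SignType) := by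
    ext x
    simp only [mem_onSupp, Fintype.mem_piFinset]
    refine forall_congr' fun a => forall_congr' fun b => ?_
    by_cases hb : b ∈ T a
    · simp only [hb, iff_true, if_true]
      generalize x a b = u; revert u; decide
    · simp [hb]
  rw [h, Fintype.card_piFinset]
  have h2 : ∀ a, (Fintype.piFinset fun b =>
      (if b ∈ T a then {1, -1} else {0} : Finset SignType)).card = 2 ^ (T a).card := by
    intro a
    rw [Fintype.card_piFinset]
    have : ∀ b, (if b ∈ T a then {1, -1} else {0} : Finset SignType).card =
        if b ∈ T a then 2 else 1 := by
      intro b; split_ifs <;> rfl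
    simp [this]
  rw [prod_congr rfl fun a _ => h2 a, prod_pow_eq_pow_sum, sum_card_row hT]

theorem card_lines {U : Finset β} (hU : U.card = 2) :
    (univ.filter fun f : β → SignType => (∀ b, f b ≠ 0 ↔ b ∈ U) ∧ ∏ b ∈ U, f b = -1).card = 2 := by
  obtain ⟨u, v, huv, rfl⟩ := card_eq_two.1 hU
  have h : (univ.filter fun f : β → SignType =>
      (∀ b, f b ≠ 0 ↔ b ∈ ({u, v} : Finset β)) ∧ ∏ b ∈ ({u, v} : Finset β), f b = -1) =
      {fun b => if b = u then 1 else if b = v then -1 else 0,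
       fun b => if b = u then -1 else if b = v then 1 else 0} := by
    ext f
    simp only [mem_filter, mem_univ, true_and, mem_insert, mem_singleton, prod_pair huv]
    constructor
    · rintro ⟨h1, h2⟩
      have h0 : ∀ b, b ≠ u → b ≠ v → f b = 0 := fun b hu hv => by
        by_contra h; simpa [hu, hv] using (h1 b).1 h
      have : (f u = 1 ∧ f v = -1) ∨ (f u = -1 ∧ f v = 1) := by
        revert h2; generalize f u = x; generalize f v = y; cases x <;> cases y <;> decide
      refine this.imp (fun h => funext fun b => ?_) (fun h => funext fun b => ?_)
      all_goals
        split_ifs with e1 e2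
        · rw [e1, h.1]
        · rw [e2, h.2]
        · exact h0 b e1 e2
    · rintro (rfl | rfl)
      all_goals
        refine ⟨fun b => ?_, by simp [huv.symm]⟩
        by_cases e1 : b = u <;> by_cases e2 : b = v <;> simp [e1, e2, huv.symm]
  rw [h, card_pair]
  intro h
  have := congrFun h u
  simp only [if_true] at this
  revert this; decide

/-- The rows are independent, and of the four sign choices in a nonempty row two have product `-1`.
-/
theorem card_rowProd {T : α → Finset β} {d : ℕ} (hT : IsTwoRel d T)
    [DecidablePred (RowProd T (-1))] : ((onSupp T).filter (RowProd T (-1))).card = 2 ^ d := by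
  have h : (onSupp T).filter (RowProd T (-1)) = Fintype.piFinset fun a =>
      univ.filter fun f : β → SignType => (∀ b, f b ≠ 0 ↔ b ∈ T a) ∧
        ((T a).Nonempty → ∏ b ∈ T a, f b = -1) := by
    ext x
    simp only [mem_filter, mem_onSupp, Fintype.mem_piFinset, mem_univ, true_and, RowProd]
    exact ⟨fun h a => ⟨h.1 a, h.2 a⟩, fun h => ⟨fun a => (h a).1, fun a => (h a).2⟩⟩
  rw [h, Fintype.card_piFinset]
  have h2 : ∀ a, (univ.filter fun f : β → SignType => (∀ b, f b ≠ 0 ↔ b ∈ T a) ∧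
        ((T a).Nonempty → ∏ b ∈ T a, f b = -1)).card = if (T a).Nonempty then 2 else 1 := by
    intro a
    split_ifs with ha
    · rw [← card_lines (hT.row a ha)]
      congr 1
      ext f; simp [ha]
    · rw [card_eq_one]
      refine ⟨0, ?_⟩
      ext f
      rw [not_nonempty_iff_eq_empty] at ha
      simp [ha, funext_iff]
  rw [prod_congr rfl fun a _ => h2 a, prod_ite]
  simp [hT.card]

theorem IsTwoRel.colOf {T : α → Finset β} {d : ℕ} (hT : IsTwoRel d T) : IsTwoRel d (colOf T) where
  row := hT.col
  col a h := by rw [colOf_colOf] at h ⊢; exact hT.row a h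
  card := by
    apply le_antisymm (card_nonempty_col_le hT)
    have h : (univ.filter fun a => (T a).Nonempty).card * 2 ≤
        (univ.filter fun b => (BentSquares.colOf T b).Nonempty).card * 2 := by
      refine (card_mul_two_le hT _ fun a ha => (mem_filter.1 ha).2).trans ?_
      refine Nat.mul_le_mul_right _ (card_le_card fun b hb => ?_)
      obtain ⟨a, -, hb⟩ := mem_biUnion.1 hb
      exact mem_filter.2 ⟨mem_univ _, a, mem_colOf.2 hb⟩
    rw [hT.card] at h
    omega

theorem card_colProd {T : α → Finset β} {d : ℕ} (hT : IsTwoRel d T)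
    [DecidablePred (ColProd T (-1))] : ((onSupp T).filter (ColProd T (-1))).card = 2 ^ d := by
  classical
  rw [← card_rowProd hT.colOf]
  refine card_bij' (fun x _ b a => x a b) (fun x _ a b => x b a) ?_ ?_ ?_ ?_
  · intro x hx
    simp only [mem_filter, mem_onSupp, mem_colOf, RowProd, ColProd] at hx ⊢
    exact ⟨fun b a => hx.1 a b, hx.2⟩
  · intro x hx
    simp only [mem_filter, mem_onSupp, mem_colOf, RowProd, ColProd] at hx ⊢
    exact ⟨fun b a => hx.1 a b, hx.2⟩
  · intro x hx; rfl
  · intro x hx; rfl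

theorem signType_mul_self {x : SignType} (h : x ≠ 0) : x * x = 1 := by
  revert h; cases x <;> decide

theorem signType_mul_ne_zero {x y : SignType} : x * y ≠ 0 ↔ x ≠ 0 ∧ y ≠ 0 := by
  cases x <;> cases y <;> decide

/-- The sign arrays on `T` with line products `1` form a torsor over those with products `-1`. -/
theorem card_rowProd_colProd {T : α → Finset β} {d : ℕ} (hT : IsTwoRel d T)
    [DecidablePred fun x => RowProd T 1 x ∧ ColProd T 1 x]
    [DecidablePred fun x => RowProd T (-1) x ∧ ColProd T (-1) x] :
    ((onSupp T).filter fun x => RowProd T 1 x ∧ ColProd T 1 x).card =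
      ((onSupp T).filter fun x => RowProd T (-1) x ∧ ColProd T (-1) x).card := by
  classical
  obtain ⟨m, hmT, hrow, hcol⟩ := exists_matching hT
  -- With `-1` exactly on a perfect matching, each nonempty line of `x₀` has one `-1`. Pointwise
  -- multiplication by `x₀` is then an involution on the arrays with support `T` that negates all
  -- line products.
  let x₀ : α → β → SignType := fun a b => if b ∈ T a then (if m a b then -1 else 1) else 0
  have hx₀ : ∀ a b, x₀ a b ≠ 0 ↔ b ∈ T a := by
    intro a b
    by_cases h : b ∈ T a <;> by_cases h' : m a b <;> simp [x₀, h, h']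
  have hsq : ∀ a b, b ∈ T a → x₀ a b * x₀ a b = 1 := fun a b h =>
    signType_mul_self ((hx₀ a b).2 h)
  have hr : RowProd T (-1) x₀ := by
    intro a ha
    obtain ⟨b, hb, hu⟩ := hrow a ha
    have : ∀ c ∈ T a, x₀ a c = if c = b then -1 else 1 := by
      intro c hc
      simp only [x₀, hc, if_true]
      congr 1
      exact propext ⟨fun h => hu c h, fun h => h ▸ hb⟩
    rw [prod_congr rfl this, prod_ite_eq' (T a) b fun _ => (-1 : SignType), if_pos (hmT a b hb)]
  have hc : ColProd T (-1) x₀ := by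
    intro b hb
    obtain ⟨a, ha, hu⟩ := hcol b hb
    have : ∀ c ∈ colOf T b, x₀ c b = if c = a then -1 else 1 := by
      intro c hc
      simp only [x₀, mem_colOf.1 hc, if_true]
      congr 1
      exact propext ⟨fun h => hu c h, fun h => h ▸ ha⟩
    rw [prod_congr rfl this, prod_ite_eq' (colOf T b) a fun _ => (-1 : SignType),
      if_pos (mem_colOf.2 (hmT a b ha))]
  have key : ∀ (ε : SignType) (x : α → β → SignType), x ∈ onSupp T →
      RowProd T ε x ∧ ColProd T ε x →
      (fun a b => x₀ a b * x a b) ∈ onSupp T ∧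
        RowProd T (-1 * ε) (fun a b => x₀ a b * x a b) ∧
        ColProd T (-1 * ε) (fun a b => x₀ a b * x a b) := by
    intro ε x hx h
    refine ⟨?_, fun a ha => ?_, fun b hb => ?_⟩
    · rw [mem_onSupp] at hx ⊢
      intro a b
      rw [signType_mul_ne_zero, hx₀, hx, and_self]
    · rw [prod_mul_distrib, hr a ha, h.1 a ha]
    · rw [prod_mul_distrib, hc b hb, h.2 b hb]
  have inv : ∀ x ∈ onSupp T, (fun a b => x₀ a b * (x₀ a b * x a b)) = x := by
    intro x hx
    funext a b
    rw [← mul_assoc]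
    by_cases h : b ∈ T a
    · rw [hsq a b h, one_mul]
    · rw [mem_onSupp] at hx
      have : x a b = 0 := by
        by_contra h'; exact h ((hx a b).1 h')
      rw [this, mul_zero]
  refine card_bij' (fun x _ a b => x₀ a b * x a b) (fun x _ a b => x₀ a b * x a b) ?_ ?_ ?_ ?_
  · intro x hx
    rw [mem_filter] at hx ⊢
    exact key 1 x hx.1 hx.2
  · intro x hx
    rw [mem_filter] at hx ⊢
    exact key (-1) x hx.1 hx.2
  · intro x hx
    exact inv x (mem_filter.1 hx).1
  · intro x hx
    exact inv x (mem_filter.1 hx).1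

open Classical in
/-- The arrays on doubled index sets whose support is a union of full blocks of order two and in
which the nonzero lines, `2d` of them in each direction, have four elements with product `-1`. -/
noncomputable def blockArrays (α β : Type*) [Fintype α] [Fintype β] [DecidableEq α]
    [DecidableEq β] (d : ℕ) : Finset (α × Bool → β × Bool → SignType) :=
  univ.filter fun M => IsSignArray 4 M ∧ (rowSet M).card = 2 * d ∧
    ∀ a x b y, M (a, x) (b, y) = 0 ↔ M (a, false) (b, false) = 0

theorem mem_blockArrays {d : ℕ} {M : α × Bool → β × Bool → SignType} :
    M ∈ blockArrays α β d ↔ IsSignArray 4 M ∧ (rowSet M).card = 2 * d ∧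
      ∀ a x b y, M (a, x) (b, y) = 0 ↔ M (a, false) (b, false) = 0 := by
  classical
  rw [blockArrays, mem_filter]
  simp

/-- The relation formed by the nonzero blocks. -/
def blockRel (M : α × Bool → β × Bool → SignType) (a : α) : Finset β :=
  univ.filter fun b => M (a, false) (b, false) ≠ 0

theorem isLine_iff_of_supp {γ : Type*} [Fintype γ] {k : ℕ} {f : γ → SignType} {U : Finset γ}
    (hU : supp f = U) : IsLine k f ↔ (U.Nonempty → U.card = k ∧ ∏ b ∈ U, f b = -1) := by
  subst hU
  rw [IsLine, ← supp_eq_empty, ← not_nonempty_iff_eq_empty]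
  tauto

/-- A nonzero line crosses two full blocks, in two entries each, so its product is a product over
`T` of products of pairs. -/
theorem mem_blockArrays_iff {d : ℕ} {T : α → Finset β} {M : α × Bool → β × Bool → SignType} :
    (M ∈ blockArrays α β d ∧ blockRel M = T) ↔ IsTwoRel d T ∧
      (∀ a x b y, M (a, x) (b, y) ≠ 0 ↔ b ∈ T a) ∧
      (∀ x, RowProd T (-1) fun a b => M (a, x) (b, false) * M (a, x) (b, true)) ∧
      ∀ y, ColProd T (-1) fun a b => M (a, false) (b, y) * M (a, true) (b, y) := by
  have aux : (∀ a x b y, M (a, x) (b, y) ≠ 0 ↔ b ∈ T a) →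
      (IsSignArray 4 M ∧ (rowSet M).card = 2 * d ↔ IsTwoRel d T ∧
      (∀ x, RowProd T (-1) fun a b => M (a, x) (b, false) * M (a, x) (b, true)) ∧
      ∀ y, ColProd T (-1) fun a b => M (a, false) (b, y) * M (a, true) (b, y)) := by
    intro h
    have hrow : ∀ a x, supp (M (a, x)) = T a ×ˢ univ := by
      intro a x; ext ⟨b, y⟩; rw [mem_supp, h]; simp
    have hcol : ∀ b y, supp (fun c => M c (b, y)) = colOf T b ×ˢ univ := by
      intro b y; ext ⟨a, x⟩; rw [mem_supp, h]; simp
    have hset : rowSet M = (univ.filter fun a => (T a).Nonempty) ×ˢ univ := by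
      ext ⟨a, x⟩
      rw [rowSet, mem_filter, hrow]
      simp
    have e1 : ∀ a x, IsLine 4 (M (a, x)) ↔ ((T a).Nonempty → (T a).card = 2 ∧
        ∏ b ∈ T a, M (a, x) (b, false) * M (a, x) (b, true) = -1) := by
      intro a x
      rw [isLine_iff_of_supp (hrow a x), prod_product, card_product]
      simp only [Fintype.prod_bool, card_univ, Fintype.card_bool, nonempty_product,
        univ_nonempty, and_true]
      refine imp_congr_right fun _ => and_congr (by omega) ?_
      simp_rw [mul_comm]
    have e2 : ∀ b y, IsLine 4 (fun c => M c (b, y)) ↔ ((colOf T b).Nonempty → (colOf T b).card = 2 ∧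
        ∏ a ∈ colOf T b, M (a, false) (b, y) * M (a, true) (b, y) = -1) := by
      intro b y
      rw [isLine_iff_of_supp (hcol b y), prod_product, card_product]
      simp only [Fintype.prod_bool, card_univ, Fintype.card_bool, nonempty_product,
        univ_nonempty, and_true]
      refine imp_congr_right fun _ => and_congr (by omega) ?_
      simp_rw [mul_comm]
    have e3 : (rowSet M).card = 2 * d ↔ (univ.filter fun a => (T a).Nonempty).card = d := by
      rw [hset, card_product, card_univ, Fintype.card_bool]
      omega
    rw [e3, IsSignArray]
    simp only [Prod.forall, e1, e2]
    constructor
    · rintro ⟨⟨h1, h2⟩, h3⟩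
      exact ⟨⟨fun a ha => (h1 a false ha).1, fun b hb => (h2 b false hb).1, h3⟩,
        fun x a ha => (h1 a x ha).2, fun y b hb => (h2 b y hb).2⟩
    · rintro ⟨⟨h1, h2, h3⟩, h4, h5⟩
      exact ⟨⟨fun a x ha => ⟨h1 a ha, h4 x a ha⟩, fun b y hb => ⟨h2 b hb, h5 y b hb⟩⟩, h3⟩
  rw [mem_blockArrays]
  constructor
  · rintro ⟨⟨h1, h2, h3⟩, h4⟩
    have h : ∀ a x b y, M (a, x) (b, y) ≠ 0 ↔ b ∈ T a := by
      intro a x b y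
      rw [← h4, blockRel, mem_filter, Ne, h3]
      simp
    obtain ⟨h5, h6⟩ := (aux h).1 ⟨h1, h2⟩
    exact ⟨h5, h, h6⟩
  · rintro ⟨h1, h2, h3⟩
    obtain ⟨h5, h6⟩ := (aux h2).2 ⟨h1, h3⟩
    refine ⟨⟨h5, h6, fun a x b y => ?_⟩, ?_⟩
    · rw [← not_iff_not, ← Ne, ← Ne, h2, h2]
    · ext a b
      simp [blockRel, h2]

/-- Describe each block by its corner `u`, the product `r` of its first row, the product `c` of its
first column and the product `p` of all four entries. The line conditions become: `u` free (`2^(2d)`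
choices), `r` with row products `-1` (`2^d`), `c` with column products `-1` (`2^d`), and `p` with
all line products `1`. By the torsor property, the `p` are as many as the arrays on `T` with all
line products `-1`, which are the two-element-line arrays with support `T`. -/
theorem card_blockArrays_fiber {d : ℕ} {T : α → Finset β} (hT : IsTwoRel d T) :
    ((blockArrays α β d).filter fun M => blockRel M = T).card =
      2 ^ (4 * d) * ((twoArrays α β d).filter fun w => (fun a => supp (w a)) = T).card := by
  classical
  have hw : (twoArrays α β d).filter (fun w => (fun a => supp (w a)) = T) =
      (onSupp T).filter fun x => RowProd T (-1) x ∧ ColProd T (-1) x := by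
    ext w
    rw [mem_filter, mem_filter, mem_twoArrays, mem_onSupp]
    have aux : (∀ a, supp (w a) = T a) → (IsSignArray 2 w ∧ (rowSet w).card = d ↔
        RowProd T (-1) w ∧ ColProd T (-1) w) := by
      intro h
      have hcol : ∀ b, supp (fun a => w a b) = colOf T b := by
        intro b; ext a; rw [mem_colOf, ← h]; simp
      have hset : rowSet w = univ.filter fun a => (T a).Nonempty := by
        simp only [rowSet, h]
      rw [hset, IsSignArray]
      simp only [isLine_iff_of_supp (h _), isLine_iff_of_supp (hcol _), hT.card, and_true]
      exact ⟨fun h => ⟨fun a ha => (h.1 a ha).2, fun b hb => (h.2 b hb).2⟩,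
        fun h => ⟨fun a ha => ⟨hT.row a ha, h.1 a ha⟩, fun b hb => ⟨hT.col b hb, h.2 b hb⟩⟩⟩
    constructor
    · rintro ⟨h1, h2⟩
      have h2 := fun a => congrFun h2 a
      exact ⟨fun a b => by rw [← h2, mem_supp], (aux h2).1 h1⟩
    · rintro ⟨h1, h2⟩
      have h3 : ∀ a, supp (w a) = T a := fun a => by ext b; rw [mem_supp, h1]
      exact ⟨(aux h3).2 h2, funext h3⟩
  rw [hw, ← card_rowProd_colProd hT]
  have hcard : 2 ^ (4 * d) * ((onSupp T).filter fun x => RowProd T 1 x ∧ ColProd T 1 x).card =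
      (onSupp T ×ˢ (onSupp T).filter (RowProd T (-1)) ×ˢ (onSupp T).filter (ColProd T (-1)) ×ˢ
        (onSupp T).filter fun x => RowProd T 1 x ∧ ColProd T 1 x).card := by
    rw [card_product, card_product, card_product, card_onSupp hT, card_rowProd hT,
      card_colProd hT]
    ring
  rw [hcard]
  refine card_bij'
    (fun M _ => (fun a b => M (a, false) (b, false),
      fun a b => M (a, false) (b, false) * M (a, false) (b, true),
      fun a b => M (a, false) (b, false) * M (a, true) (b, false),
      fun a b => (M (a, false) (b, false) * M (a, false) (b, true)) *
        (M (a, true) (b, false) * M (a, true) (b, true))))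
    -- The inverse change of variables: the entries of a block are `u`, `u r`, `u c` and `u r c p`.
    (fun p _ => fun r c => p.1 r.1 c.1 * ((if c.2 then p.2.1 r.1 c.1 else 1) *
      ((if r.2 then p.2.2.1 r.1 c.1 else 1) * if r.2 && c.2 then p.2.2.2 r.1 c.1 else 1))) ?_ ?_ ?_ ?_
  · intro M hM
    obtain ⟨-, h1, h2, h3⟩ := mem_blockArrays_iff.1 (mem_filter.1 hM)
    simp only [mem_product, mem_filter, mem_onSupp, signType_mul_ne_zero, h1, and_self,
      implies_true, true_and]
    refine ⟨h2 false, h3 false, fun a ha => ?_, fun b hb => ?_⟩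
    · rw [prod_mul_distrib, h2 false a ha, h2 true a ha]; rfl
    · have : ∀ a, (M (a, false) (b, false) * M (a, false) (b, true)) *
        (M (a, true) (b, false) * M (a, true) (b, true)) =
        (M (a, false) (b, false) * M (a, true) (b, false)) *
        (M (a, false) (b, true) * M (a, true) (b, true)) := fun a => by ac_rfl
      simp only [this]
      rw [prod_mul_distrib, h3 false b hb, h3 true b hb]; rfl
  · rintro ⟨u, r, c, p⟩ hp
    simp only [mem_product, mem_filter, mem_onSupp] at hp
    obtain ⟨hu, ⟨hr, hr'⟩, ⟨hc, hc'⟩, hp, hp1, hp2⟩ := hp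
    rw [mem_filter, mem_blockArrays_iff]
    have one_ne : (1 : SignType) ≠ 0 := by decide
    have hsq : ∀ a b, b ∈ T a → u a b * u a b = 1 ∧ r a b * r a b = 1 ∧ c a b * c a b = 1 :=
      fun a b h => ⟨signType_mul_self ((hu a b).2 h), signType_mul_self ((hr a b).2 h),
        signType_mul_self ((hc a b).2 h)⟩
    refine ⟨hT, ?_, ?_, ?_⟩
    · intro a x b y
      cases x <;> cases y <;>
        simp only [signType_mul_ne_zero, hu, hr, hc, hp, one_ne, if_true, if_false, Bool.and_true,
          Bool.and_false, and_self, ne_eq, not_false_eq_true, and_true, true_and, Bool.false_eq_true]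
    · intro x a ha
      cases x
      · rw [← hr' a ha]
        refine prod_congr rfl fun b hb => ?_
        obtain ⟨h1, h2, h3⟩ := hsq a b hb
        simp only [if_true, if_false, Bool.false_eq_true, mul_one, Bool.and_true, Bool.false_and,
          Bool.and_false]
        rw [← mul_assoc, h1, one_mul]
      · have e : (∏ b ∈ T a, r a b) * ∏ b ∈ T a, p a b = -1 := by
          rw [hr' a ha, hp1 a ha]; rfl
        rw [← e, ← prod_mul_distrib]
        refine prod_congr rfl fun b hb => ?_
        obtain ⟨h1, h2, h3⟩ := hsq a b hb
        simp only [if_true, if_false, Bool.false_eq_true, mul_one, Bool.and_true,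
          Bool.and_false, one_mul]
        calc _ = (u a b * u a b) * ((c a b * c a b) * (r a b * p a b)) := by ac_rfl
          _ = _ := by rw [h1, h3, one_mul, one_mul]
    · intro y b hb
      cases y
      · rw [← hc' b hb]
        refine prod_congr rfl fun a ha => ?_
        obtain ⟨h1, h2, h3⟩ := hsq a b (mem_colOf.1 ha)
        simp only [if_true, if_false, Bool.false_eq_true, mul_one, Bool.and_true,
          Bool.and_false, one_mul]
        rw [← mul_assoc, h1, one_mul]
      · have e : (∏ a ∈ colOf T b, c a b) * ∏ a ∈ colOf T b, p a b = -1 := by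
          rw [hc' b hb, hp2 b hb]; rfl
        rw [← e, ← prod_mul_distrib]
        refine prod_congr rfl fun a ha => ?_
        obtain ⟨h1, h2, h3⟩ := hsq a b (mem_colOf.1 ha)
        simp only [if_true, if_false, Bool.false_eq_true, mul_one, Bool.and_true, Bool.false_and,
          Bool.and_false, one_mul]
        calc _ = (u a b * u a b) * ((r a b * r a b) * (c a b * p a b)) := by ac_rfl
          _ = _ := by rw [h1, h2, one_mul, one_mul]
  · intro M hM
    obtain ⟨-, h1, -, -⟩ := mem_blockArrays_iff.1 (mem_filter.1 hM)
    funext ⟨a, x⟩ ⟨b, y⟩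
    by_cases hb : b ∈ T a
    · have e : ∀ x y, M (a, x) (b, y) * M (a, x) (b, y) = 1 := fun x y =>
        signType_mul_self ((h1 a x b y).2 hb)
      have h00 := (h1 a false b false).2 hb
      have h01 := (h1 a false b true).2 hb
      have h10 := (h1 a true b false).2 hb
      have h11 := (h1 a true b true).2 hb
      cases x <;> cases y <;> simp only [if_true, if_false, Bool.false_eq_true, mul_one, one_mul,
        Bool.and_true, Bool.and_false]
      · rw [← mul_assoc, e, one_mul]
      · rw [← mul_assoc, e, one_mul]
      · revert h00 h01 h10 h11
        generalize M (a, false) (b, false) = p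
        generalize M (a, false) (b, true) = q
        generalize M (a, true) (b, false) = r
        generalize M (a, true) (b, true) = s
        revert p q r s
        decide
    · have e : ∀ x y, M (a, x) (b, y) = 0 := fun x y => by
        by_contra h; exact hb ((h1 a x b y).1 h)
      simp [e]
  · rintro ⟨u, r, c, p⟩ hp
    simp only [mem_product, mem_filter, mem_onSupp] at hp
    obtain ⟨hu, ⟨hr, -⟩, ⟨hc, -⟩, hp, -⟩ := hp
    have key : ∀ U R C P : SignType, (U ≠ 0 ↔ R ≠ 0) → (U ≠ 0 ↔ C ≠ 0) → (U ≠ 0 ↔ P ≠ 0) →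
        U * (U * R) = R ∧ U * (U * C) = C ∧ U * (U * R) * (U * C * (U * (R * (C * P)))) = P := by
      decide
    have key' := fun a b => key (u a b) (r a b) (c a b) (p a b) (by rw [hu, hr]) (by rw [hu, hc])
      (by rw [hu, hp])
    simp only [if_true, if_false, Bool.false_eq_true, mul_one, one_mul, Bool.and_true,
      Bool.and_false]
    exact Prod.ext rfl (Prod.ext (funext₂ fun a b => (key' a b).1)
      (Prod.ext (funext₂ fun a b => (key' a b).2.1) (funext₂ fun a b => (key' a b).2.2)))

/-- The factor `2^(4d)` is the same for every `T`, so summing over `T` compares the totals without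
counting the relations `T` themselves. -/
theorem card_blockArrays (d : ℕ) :
    (blockArrays α β d).card = 2 ^ (4 * d) * (twoArrays α β d).card := by
  classical
  rw [card_eq_sum_card_fiberwise (s := blockArrays α β d) (f := blockRel)
      (t := univ.filter fun T => IsTwoRel d T),
    card_eq_sum_card_fiberwise (s := twoArrays α β d) (f := fun w a => supp (w a))
      (t := univ.filter fun T => IsTwoRel d T), mul_sum]
  · exact sum_congr rfl fun T hT => card_blockArrays_fiber (mem_filter.1 hT).2
  · intro w hw
    obtain ⟨h1, h2⟩ := mem_twoArrays.1 hw
    have hcol : ∀ b, colOf (fun a => supp (w a)) b = supp (fun a => w a b) := by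
      intro b; ext a; simp
    refine mem_filter.2 ⟨mem_univ _, ?_, ?_, h2⟩
    · exact fun a ha => ((isLine_iff_of_supp rfl).1 (h1.1 a) ha).1
    · intro b hb
      rw [hcol] at hb ⊢
      exact ((isLine_iff_of_supp rfl).1 (h1.2 b) hb).1
  · intro M hM
    exact mem_filter.2 ⟨mem_univ _, (mem_blockArrays_iff.1 ⟨hM, rfl⟩).1⟩

end Supports

/-! ### Arrays composed of blocks placed along a bijection -/

section Blocks
variable {α β ι κ : Type*} [Fintype α] [Fintype β] [DecidableEq α] [DecidableEq β]
  [Fintype ι] [Fintype κ] [DecidableEq ι] [DecidableEq κ]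

/-- The rows of `M` in `A`; the other rows are replaced by zeros. -/
def restrictRows (A : Finset α) (M : α → β → SignType) : α → β → SignType :=
  fun a b => if a ∈ A then M a b else 0

/-- `M` is composed of the blocks from `P i (π i)` on the rows `A i`. -/
def IsBlockPerm (A : ι → Finset α) (P : ι → κ → Finset (α → β → SignType)) (π : ι ≃ κ)
    (M : α → β → SignType) : Prop :=
  (∀ i, restrictRows (A i) M ∈ P i (π i)) ∧ ∀ a, (∀ i, a ∉ A i) → M a = 0

/-- For fixed `π`, the disjointness of the row sets makes the choices of blocks independent. -/
theorem card_isBlockPerm {A : ι → Finset α} {B : κ → Finset β}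
    (hd : ∀ i j, i ≠ j → Disjoint (A i) (A j))
    {P : ι → κ → Finset (α → β → SignType)}
    (hP : ∀ i j, ∀ N ∈ P i j, ∀ a b, N a b ≠ 0 ↔ a ∈ A i ∧ b ∈ B j) (π : ι ≃ κ)
    [DecidablePred (IsBlockPerm A P π)] :
    (univ.filter (IsBlockPerm A P π)).card = ∏ i, (P i (π i)).card := by
  classical
  rw [← Fintype.card_piFinset]
  have huniq : ∀ i j a, a ∈ A i → a ∈ A j → i = j := by
    intro i j a hi hj
    by_contra h
    exact disjoint_left.1 (hd i j h) hi hj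
  refine card_bij (fun M _ i => restrictRows (A i) M) ?_ ?_ ?_
  · intro M hM
    rw [Fintype.mem_piFinset]
    exact (mem_filter.1 hM).2.1
  · intro M hM M' hM' h
    funext a b
    by_cases ha : ∃ i, a ∈ A i
    · obtain ⟨i, hi⟩ := ha
      have := congrFun₂ (congrFun h i) a b
      simpa [restrictRows, hi] using this
    · push Not at ha
      rw [(mem_filter.1 hM).2.2 a ha, (mem_filter.1 hM').2.2 a ha]
  · intro N hN
    rw [Fintype.mem_piFinset] at hN
    let M : α → β → SignType := fun a b => if h : ∃ i, a ∈ A i then N h.choose a b else 0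
    have hM : ∀ i, restrictRows (A i) M = N i := by
      intro i
      funext a b
      by_cases hi : a ∈ A i
      · have hex : ∃ i, a ∈ A i := ⟨i, hi⟩
        simp only [restrictRows, hi, if_true, M, hex, dif_pos]
        rw [huniq _ _ a hex.choose_spec hi]
      · simp only [restrictRows, hi, if_false]
        by_contra h
        exact hi ((hP i _ _ (hN i) a b).1 (Ne.symm h)).1
    refine ⟨M, mem_filter.2 ⟨mem_univ _, fun i => by rw [hM]; exact hN i, fun a ha => ?_⟩,
      funext hM⟩
    funext b
    have hex : ¬ ∃ i, a ∈ A i := by simpa using ha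
    simp [M, hex]

/-- The support of a row in the nonempty set `A i` is `B (π i)`, so `π` can be read off the array
and different `π` give disjoint classes. The lemma serves both the monomial arrays (blocks of order
one) and the arrays with blocks of order four. -/
theorem card_blockPerm {A : ι → Finset α} {B : κ → Finset β} (hA : ∀ i, (A i).Nonempty)
    (hd : ∀ i j, i ≠ j → Disjoint (A i) (A j)) (hB : Function.Injective B)
    {P : ι → κ → Finset (α → β → SignType)}
    (hP : ∀ i j, ∀ N ∈ P i j, ∀ a b, N a b ≠ 0 ↔ a ∈ A i ∧ b ∈ B j) {c : ℕ}
    (hc : ∀ i j, (P i j).card = c) (hcard : Fintype.card ι = Fintype.card κ)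
    [DecidablePred fun M => ∃ π, IsBlockPerm A P π M] :
    (univ.filter fun M => ∃ π, IsBlockPerm A P π M).card =
      (Fintype.card ι)! * c ^ Fintype.card ι := by
  classical
  have h : (univ.filter fun M => ∃ π, IsBlockPerm A P π M) =
      univ.biUnion fun π => univ.filter (IsBlockPerm A P π) := by
    ext M; simp
  rw [h, card_biUnion]
  · rw [sum_congr rfl fun π _ => card_isBlockPerm hd hP π]
    simp only [hc, prod_const, sum_const, card_univ, smul_eq_mul]
    rw [Fintype.card_equiv (Fintype.equivOfCardEq hcard)]
  · intro π _ π' _ hne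
    rw [Function.onFun, disjoint_left]
    intro M hM hM'
    apply hne
    ext i
    apply hB
    obtain ⟨a, ha⟩ := hA i
    ext b
    have h1 := hP _ _ _ ((mem_filter.1 hM).2.1 i) a b
    have h2 := hP _ _ _ ((mem_filter.1 hM').2.1 i) a b
    simp only [ha, true_and] at h1 h2
    rw [← h1, ← h2]

/-- The arrays having nonzero elements only in the rows `R` and the columns `C`,
exactly one in each of these rows and columns. -/
def IsMonomial (R : Finset α) (C : Finset β) (G : α → β → SignType) : Prop :=
  (∀ a b, G a b ≠ 0 → a ∈ R ∧ b ∈ C) ∧ (∀ a ∈ R, ∃! b, G a b ≠ 0) ∧ ∀ b ∈ C, ∃! a, G a b ≠ 0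

theorem card_supported_singleton (a : α) (b : β) :
    (univ.filter fun N : α → β → SignType =>
      ∀ x y, N x y ≠ 0 ↔ x ∈ ({a} : Finset α) ∧ y ∈ ({b} : Finset β)).card = 2 := by
  have h : (univ.filter fun N : α → β → SignType =>
      ∀ x y, N x y ≠ 0 ↔ x ∈ ({a} : Finset α) ∧ y ∈ ({b} : Finset β)) =
      {fun x y => if x = a ∧ y = b then 1 else 0, fun x y => if x = a ∧ y = b then -1 else 0} := by
    ext N
    simp only [mem_filter, mem_univ, true_and, mem_insert, mem_singleton]
    constructor
    · intro h
      have h0 : ∀ x y, ¬ (x = a ∧ y = b) → N x y = 0 := fun x y hxy => by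
        by_contra h'; exact hxy ((h x y).1 h')
      refine (signType_eq_one_or ((h a b).2 ⟨rfl, rfl⟩)).imp (fun e => ?_) (fun e => ?_)
      all_goals
        funext x y
        split_ifs with hxy
        · rw [hxy.1, hxy.2, e]
        · exact h0 x y hxy
    · rintro (rfl | rfl) x y
      all_goals by_cases hxy : x = a ∧ y = b <;> simp [hxy]
  rw [h, card_pair]
  intro h
  have := congrFun₂ h a b
  simp at this

theorem card_monomial {R : Finset α} {C : Finset β} (h : R.card = C.card)
    [DecidablePred (IsMonomial R C)] :
    (univ.filter (IsMonomial R C)).card = (R.card)! * 2 ^ R.card := by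
  classical
  have key := card_blockPerm (A := fun a : R => ({(a : α)} : Finset α))
    (B := fun b : C => ({(b : β)} : Finset β)) (fun a => singleton_nonempty _)
    (fun a a' haa => disjoint_singleton.2 fun e => haa (Subtype.ext e))
    (fun b b' hbb => Subtype.ext (singleton_injective hbb))
    (P := fun a b => univ.filter fun N => ∀ x y, N x y ≠ 0 ↔
      x ∈ ({(a : α)} : Finset α) ∧ y ∈ ({(b : β)} : Finset β))
    (fun a b N hN => (mem_filter.1 hN).2) (fun a b => card_supported_singleton _ _)
    (by simpa using h)
  rw [Fintype.card_coe] at key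
  rw [← key]
  congr 1
  ext G
  simp only [mem_filter, mem_univ, true_and, IsBlockPerm, mem_singleton]
  constructor
  · rintro ⟨h1, h2, h3⟩
    choose f hf hfu using h2
    have hfC : ∀ a (ha : a ∈ R), f a ha ∈ C := fun a ha => (h1 _ _ (hf a ha)).2
    let g : R → C := fun a => ⟨f a a.2, hfC _ _⟩
    have hg : Function.Injective g := by
      intro a a' haa
      have e : f a a.2 = f a' a'.2 := congrArg Subtype.val haa
      have h5 := hf a' a'.2
      rw [← e] at h5
      exact Subtype.ext ((h3 _ (hfC _ a.2)).unique (hf a a.2) h5)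
    refine ⟨Equiv.ofBijective g ((Fintype.bijective_iff_injective_and_card g).2
      ⟨hg, by simpa using h⟩), fun a x y => ?_, fun a ha => ?_⟩
    · simp only [restrictRows, mem_singleton, Equiv.ofBijective_apply, g]
      split_ifs with hx
      · subst hx
        simp only [true_and]
        exact ⟨fun hy => hfu _ _ _ hy, fun hy => hy ▸ hf _ _⟩
      · simp [hx]
    · funext b
      by_contra h'
      exact ha ⟨a, (h1 a b h').1⟩ rfl
  · rintro ⟨π, h1, h2⟩
    have hrow : ∀ a : R, ∀ y, G a y ≠ 0 ↔ y = π a := by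
      intro a y
      have := h1 a a y
      simpa [restrictRows] using this
    have hR : ∀ a b, G a b ≠ 0 → a ∈ R := by
      intro a b hab
      by_contra ha
      exact hab (congrFun (h2 a fun i hi => ha (hi ▸ i.2)) b)
    refine ⟨fun a b hab => ⟨hR a b hab, ?_⟩, fun a ha => ?_, fun b hb => ?_⟩
    · have := (hrow ⟨a, hR a b hab⟩ b).1 hab
      rw [this]
      exact (π _).2
    · exact ⟨π ⟨a, ha⟩, (hrow ⟨a, ha⟩ _).2 rfl, fun y hy => (hrow ⟨a, ha⟩ y).1 hy⟩
    · refine ⟨π.symm ⟨b, hb⟩, (hrow _ _).2 (by simp), fun a ha => ?_⟩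
      have := (hrow ⟨a, hR a b ha⟩ b).1 ha
      have e : (⟨b, hb⟩ : C) = π ⟨a, hR a b ha⟩ := Subtype.ext this
      rw [e, Equiv.symm_apply_apply]

end Blocks

/-! ### Sign patterns on a full block of order four -/

section FullBlocks
variable {α β γ δ : Type*} [Fintype α] [Fintype β] [DecidableEq α] [DecidableEq β]
  [Fintype γ] [Fintype δ] [DecidableEq γ] [DecidableEq δ]

open Classical in
/-- The arrays with support `A × B` whose nonzero lines have four elements with product `-1`. -/
noncomputable def fullBlocks (A : Finset α) (B : Finset β) : Finset (α → β → SignType) :=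
  univ.filter fun N => (∀ a b, N a b ≠ 0 ↔ a ∈ A ∧ b ∈ B) ∧ IsSignArray 4 N

theorem mem_fullBlocks {A : Finset α} {B : Finset β} {N : α → β → SignType} :
    N ∈ fullBlocks A B ↔ (∀ a b, N a b ≠ 0 ↔ a ∈ A ∧ b ∈ B) ∧ IsSignArray 4 N := by
  classical
  rw [fullBlocks, mem_filter]
  simp

theorem isLine_of_supp_eq {A : Finset α} (e : γ ≃ A) {f : α → SignType} {k : ℕ}
    (hf : ∀ a, f a ≠ 0 ↔ a ∈ A) : IsLine k f ↔ IsLine k fun c => f (e c) := by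
  have h1 : supp f = A := by ext a; rw [mem_supp, hf]
  have h2 : (supp fun c => f (e c)) = univ := by
    ext c; simp [hf]
  rw [isLine_iff_of_supp h1, isLine_iff_of_supp h2, Equiv.prod_comp e fun a : A => f a,
    prod_coe_sort, card_univ, Fintype.card_congr e, Fintype.card_coe]
  have : (univ : Finset γ).Nonempty ↔ A.Nonempty := by
    rw [← card_pos, ← card_pos, card_univ, Fintype.card_congr e, Fintype.card_coe]
  rw [this]

theorem card_fullBlocks_of_equiv {A : Finset α} {B : Finset β} (e : γ ≃ A) (f : δ ≃ B) :
    (fullBlocks A B).card = (fullBlocks (univ : Finset γ) (univ : Finset δ)).card := by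
  refine card_bij' (fun N _ c d => N (e c) (f d))
    (fun N _ a b => if h : a ∈ A ∧ b ∈ B then N (e.symm ⟨a, h.1⟩) (f.symm ⟨b, h.2⟩) else 0) ?_ ?_ ?_ ?_
  · intro N hN
    obtain ⟨h1, h2⟩ := mem_fullBlocks.1 hN
    refine mem_fullBlocks.2 ⟨fun c d => by simp [h1], fun c => ?_, fun d => ?_⟩
    · exact (isLine_of_supp_eq f fun b => by simp [h1]).1 (h2.1 (e c))
    · exact (isLine_of_supp_eq e (f := fun a => N a (f d)) fun b => by simp [h1]).1 (h2.2 (f d))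
  · intro N hN
    obtain ⟨h1, h2⟩ := mem_fullBlocks.1 hN
    simp only [mem_univ, and_self, iff_true] at h1
    refine mem_fullBlocks.2 ⟨fun a b => ?_, fun a => ?_, fun b => ?_⟩
    · by_cases h : a ∈ A ∧ b ∈ B
      · simp only [h, and_self, dif_pos, iff_true]; exact h1 _ _
      · simp [h]
    · by_cases ha : a ∈ A
      · refine (isLine_of_supp_eq f fun b => ?_).2 ?_
        · by_cases h : b ∈ B
          · simp only [ha, h, and_self, dif_pos, iff_true]; exact h1 _ _
          · simp [h]
        · simpa [ha] using h2.1 (e.symm ⟨a, ha⟩)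
      · exact Or.inl (funext fun b => by simp [ha])
    · by_cases hb : b ∈ B
      · refine (isLine_of_supp_eq e fun a => ?_).2 ?_
        · by_cases h : a ∈ A
          · simp only [hb, h, and_self, dif_pos, iff_true]; exact h1 _ _
          · simp [h]
        · simpa [hb] using h2.2 (f.symm ⟨b, hb⟩)
      · exact Or.inl (funext fun b => by simp [hb])
  · intro N hN
    obtain ⟨h1, -⟩ := mem_fullBlocks.1 hN
    funext a b
    by_cases h : a ∈ A ∧ b ∈ B
    · simp [h]
    · simp only [h, dif_neg, not_false_eq_true]
      by_contra h'
      exact h ((h1 a b).1 (Ne.symm h'))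
  · intro N hN
    funext c d
    simp

/-- A full block of order four is a block array with `d = 2` on two doubled indices, and `2^8 * 2 =
512`. -/
theorem card_fullBlocks {A : Finset α} {B : Finset β} (hA : A.card = 4) (hB : B.card = 4) :
    (fullBlocks A B).card = 512 := by
  have eA : Fin 2 × Bool ≃ A := Fintype.equivOfCardEq (by simp [hA])
  have eB : Fin 2 × Bool ≃ B := Fintype.equivOfCardEq (by simp [hB])
  rw [card_fullBlocks_of_equiv eA eB]
  have h : fullBlocks (univ : Finset (Fin 2 × Bool)) (univ : Finset (Fin 2 × Bool)) =
      blockArrays (Fin 2) (Fin 2) 2 := by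
    ext N
    rw [mem_fullBlocks, mem_blockArrays]
    simp only [mem_univ, and_self, iff_true]
    constructor
    · rintro ⟨h1, h2⟩
      refine ⟨h2, ?_, fun a x b y => ?_⟩
      · have : rowSet N = univ := by
          ext a
          simp only [mem_rowSet, mem_univ, iff_true]
          exact ⟨a, h1 _ _⟩
        rw [this]; rfl
      · exact iff_of_false (h1 _ _) (h1 _ _)
    · rintro ⟨h1, h2, -⟩
      refine ⟨fun a b => ?_, h1⟩
      have hu : rowSet N = univ := by
        apply eq_univ_of_card
        rw [h2]; rfl
      have ha : a ∈ rowSet N := by rw [hu]; exact mem_univ _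
      obtain ⟨c, hc⟩ := mem_rowSet.1 ha
      have hs : supp (N a) = univ := by
        apply eq_univ_of_card
        rw [(h1.1 a).card_supp hc]; rfl
      rw [← mem_supp, hs]
      exact mem_univ _
  rw [h, card_blockArrays, card_twoArrays]
  rfl

end FullBlocks

/-! ### Families of four-element sets invariant under translations -/

section Translations
variable {n : ℕ}

theorem add_self_vec (a : V n) : a + a = 0 := by
  funext i
  exact CharTwo.add_self_eq_zero (a i)

theorem add_add_self_vec (a s : V n) : a + s + s = a := by
  rw [add_assoc, add_self_vec, add_zero]

theorem add_eq_iff_vec {a b s : V n} : a + s = b ↔ a = b + s :=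
  ⟨fun h => by rw [← h, add_add_self_vec], fun h => by rw [h, add_add_self_vec]⟩

/-- The set `A` is invariant under the translation by `s`. -/
def Inv (s : V n) (A : Finset (V n)) : Prop := ∀ a ∈ A, a + s ∈ A

instance (s : V n) (A : Finset (V n)) : Decidable (Inv s A) := by unfold Inv; infer_instance

theorem Inv.mem_iff {s : V n} {A : Finset (V n)} (h : Inv s A) {a : V n} : a + s ∈ A ↔ a ∈ A :=
  ⟨fun ha => by simpa [add_add_self_vec] using h _ ha, h a⟩

theorem Inv.add {s t : V n} {A : Finset (V n)} (hs : Inv s A) (ht : Inv t A) : Inv (s + t) A :=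
  fun a ha => by rw [← add_assoc]; exact ht _ (hs _ ha)

/-- The four elements obtained from `a` by the translations by `s` and `t`. -/
def plane (s t a : V n) : Finset (V n) := {a, a + s, a + t, a + s + t}

theorem card_plane {s t : V n} (hs : s ≠ 0) (ht : t ≠ 0) (hst : s ≠ t) (a : V n) :
    (plane s t a).card = 4 := by
  have h1 : a ≠ a + s := by simpa using hs
  have h2 : a ≠ a + t := by simpa using ht
  have h3 : a ≠ a + s + t := by
    rw [add_assoc]
    intro h
    have : s + t = 0 := by simpa using h
    exact hst (by rw [← zero_add t, ← this, add_add_self_vec])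
  have h4 : a + s ≠ a + t := by simpa using hst
  have h5 : a + s ≠ a + s + t := by simpa using ht
  have h6 : a + t ≠ a + s + t := by
    rw [add_right_comm]
    simpa using hs
  simp [plane, h1, h2, h3, h4, h5, h6]

theorem plane_subset {s t a : V n} {A : Finset (V n)} (hs : Inv s A) (ht : Inv t A) (ha : a ∈ A) :
    plane s t a ⊆ A := by
  intro x hx
  simp only [plane, mem_insert, mem_singleton] at hx
  rcases hx with rfl | rfl | rfl | rfl
  · exact ha
  · exact hs _ ha
  · exact ht _ ha
  · exact ht _ (hs _ ha)

/-- The translates of one point already give four elements. Hence a four-element set with two given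
directions is determined by any of its points. -/
theorem eq_plane {s t a : V n} {A : Finset (V n)} (h0 : s ≠ 0) (h0' : t ≠ 0) (hst : s ≠ t)
    (hA : A.card = 4) (hs : Inv s A) (ht : Inv t A) (ha : a ∈ A) : A = plane s t a :=
  (eq_of_subset_of_card_le (plane_subset hs ht ha) (by rw [hA, card_plane h0 h0' hst])).symm

theorem inv_plane_left (s t a : V n) : Inv s (plane s t a) := by
  intro x hx
  simp only [plane, mem_insert, mem_singleton] at hx ⊢
  rcases hx with rfl | rfl | rfl | rfl
  · simp
  · simp [add_add_self_vec]
  · right; right; right; rw [add_right_comm]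
  · right; right; left; rw [add_right_comm, add_add_self_vec]

theorem inv_plane_right (s t a : V n) : Inv t (plane s t a) := by
  intro x hx
  simp only [plane, mem_insert, mem_singleton] at hx ⊢
  rcases hx with rfl | rfl | rfl | rfl
  · simp
  · simp
  · simp [add_add_self_vec]
  · simp [add_add_self_vec]

theorem card_cosets {s t : V n} (h0 : s ≠ 0) (h0' : t ≠ 0) (hst : s ≠ t) :
    ((univ : Finset (V n)).image (plane s t)).card * 4 = 2 ^ n := by
  have h : ((univ : Finset (V n)).image (plane s t)).biUnion id = univ := by
    ext a
    simp only [mem_biUnion, mem_image, mem_univ, true_and, id, iff_true]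
    exact ⟨_, ⟨a, rfl⟩, by simp [plane]⟩
  have h2 := congrArg Finset.card h
  rw [card_biUnion, sum_const_nat (m := 4)] at h2
  · rw [h2]; simp [V]
  · intro A hA
    obtain ⟨a, -, rfl⟩ := mem_image.1 hA
    exact card_plane h0 h0' hst a
  · intro A hA B hB hAB
    obtain ⟨a, -, rfl⟩ := mem_image.1 hA
    obtain ⟨b, -, rfl⟩ := mem_image.1 hB
    rw [Function.onFun, disjoint_left]
    intro x hx hx'
    apply hAB
    rw [eq_plane h0 h0' hst (card_plane h0 h0' hst a) (inv_plane_left s t a)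
      (inv_plane_right s t a) hx, eq_plane h0 h0' hst (card_plane h0 h0' hst b)
      (inv_plane_left s t b) (inv_plane_right s t b) hx']

/-- The half of an invariant set on which a suitable coordinate vanishes has half its elements. -/
theorem card_filter_half {s : V n} {i : Fin n} (hi : s i ≠ 0) {A : Finset (V n)} (hA : Inv s A) :
    A.card = 2 * (A.filter fun a => a i = 0).card := by
  have hs : s i = 1 := Fin.eq_one_of_ne_zero _ hi
  have key : ∀ x : ZMod 2, x + 1 = 0 ↔ x ≠ 0 := by decide
  rw [← card_filter_add_card_filter_not (s := A) fun a => a i = 0, two_mul]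
  congr 1
  refine card_nbij' (fun a => a + s) (fun a => a + s) ?_ ?_ ?_ ?_
  · intro a ha
    simp only [coe_filter, Set.mem_ofPred_eq, Pi.add_apply, hs] at ha ⊢
    exact ⟨hA a ha.1, (key _).2 ha.2⟩
  · intro a ha
    simp only [coe_filter, Set.mem_ofPred_eq, Pi.add_apply, hs] at ha ⊢
    refine ⟨hA a ha.1, fun h => ?_⟩
    exact (key _).1 h ha.2
  · intro a _; exact add_add_self_vec a s
  · intro a _; exact add_add_self_vec a s

/-- An invariant four-element set is a union of two orbits `{a, a + s}`. With `s i = 1`, each orbit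
has one representative satisfying `a i = 0`, so the choice is of two among half of `U`. -/
theorem card_inv_four {s : V n} (h0 : s ≠ 0) {U : Finset (V n)} (hU : Inv s U) :
    ((U.powersetCard 4).filter (Inv s)).card = (U.card / 2).choose 2 := by
  obtain ⟨i, hi⟩ := Function.ne_iff.1 h0
  have hs : s i = 1 := Fin.eq_one_of_ne_zero _ hi
  have key : ∀ x : ZMod 2, x + 1 = 0 ↔ x ≠ 0 := by decide
  have key' : ∀ x : ZMod 2, x = 0 → x + 1 ≠ 0 := by decide
  have hc : U.card / 2 = (U.filter fun a => a i = 0).card := by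
    rw [card_filter_half hi hU]; omega
  rw [hc, ← card_powersetCard]
  have hinv : ∀ S : Finset (V n), Inv s (S ∪ S.image (· + s)) := by
    intro S a ha
    simp only [mem_union, mem_image] at ha ⊢
    rcases ha with ha | ⟨b, hb, rfl⟩
    · exact Or.inr ⟨a, ha, rfl⟩
    · left; rwa [add_add_self_vec]
  have hfil : ∀ S : Finset (V n), (∀ a ∈ S, a i = 0) →
      (S ∪ S.image (· + s)).filter (fun a => a i = 0) = S := by
    intro S hS
    ext a
    simp only [mem_filter, mem_union, mem_image]
    constructor
    · rintro ⟨ha | ⟨b, hb, rfl⟩, h⟩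
      · exact ha
      · rw [Pi.add_apply, hs] at h
        exact absurd h (key' _ (hS b hb))
    · exact fun ha => ⟨Or.inl ha, hS a ha⟩
  refine card_nbij' (fun A => A.filter fun a => a i = 0) (fun S => S ∪ S.image (· + s)) ?_ ?_ ?_ ?_
  · intro A hA
    simp only [coe_filter, Set.mem_ofPred_eq, mem_powersetCard, mem_coe] at hA ⊢
    refine ⟨filter_subset_filter _ hA.1.1, ?_⟩
    have := card_filter_half hi hA.2
    omega
  · intro S hS
    simp only [coe_filter, Set.mem_ofPred_eq, mem_powersetCard, mem_coe] at hS ⊢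
    refine ⟨⟨?_, ?_⟩, hinv S⟩
    · intro a ha
      simp only [mem_union, mem_image] at ha
      rcases ha with ha | ⟨b, hb, rfl⟩
      · exact (mem_filter.1 (hS.1 ha)).1
      · exact hU _ (mem_filter.1 (hS.1 hb)).1
    · rw [card_filter_half hi (hinv S), hfil S fun a ha => (mem_filter.1 (hS.1 ha)).2, hS.2]
  · intro A hA
    simp only [coe_filter, Set.mem_ofPred_eq, mem_powersetCard, mem_coe] at hA
    ext a
    simp only [mem_filter, mem_union, mem_image]
    constructor
    · rintro (ha | ⟨b, hb, rfl⟩)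
      · exact ha.1
      · exact hA.2 _ hb.1
    · intro ha
      by_cases h : a i = 0
      · exact Or.inl ⟨ha, h⟩
      · exact Or.inr ⟨a + s, ⟨hA.2 _ ha, by rw [Pi.add_apply, hs]; exact (key _).2 h⟩,
          add_add_self_vec a s⟩
  · intro S hS
    simp only [coe_filter, Set.mem_ofPred_eq, mem_powersetCard, mem_coe] at hS
    exact hfil S fun a ha => (mem_filter.1 (hS.1 ha)).2

open Classical in
/-- The sets of `k` pairwise disjoint four-element subsets. -/
noncomputable def fourFam (n k : ℕ) : Finset (Finset (Finset (V n))) :=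
  univ.filter fun 𝒜 => 𝒜.card = k ∧ (∀ A ∈ 𝒜, A.card = 4) ∧
    ∀ A ∈ 𝒜, ∀ B ∈ 𝒜, A ≠ B → Disjoint A B

theorem mem_fourFam {k : ℕ} {𝒜 : Finset (Finset (V n))} : 𝒜 ∈ fourFam n k ↔
    𝒜.card = k ∧ (∀ A ∈ 𝒜, A.card = 4) ∧ ∀ A ∈ 𝒜, ∀ B ∈ 𝒜, A ≠ B → Disjoint A B := by
  classical
  rw [fourFam, mem_filter]
  simp

/-- The nonzero translations preserving each member of the family. -/
def dirs (𝒜 : Finset (Finset (V n))) : Finset (V n) :=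
  univ.filter fun s => s ≠ 0 ∧ ∀ A ∈ 𝒜, Inv s A

theorem mem_dirs {𝒜 : Finset (Finset (V n))} {s : V n} :
    s ∈ dirs 𝒜 ↔ s ≠ 0 ∧ ∀ A ∈ 𝒜, Inv s A := by simp [dirs]

/-- Count families with a distinguished member. Removing that member leaves a family of `k` sets and
an invariant four-element subset of the complement, which consists of `2^(n-1) - 2k` orbits. -/
theorem card_invFam_succ {s : V n} (h0 : s ≠ 0) (k : ℕ) :
    (k + 1) * ((fourFam n (k + 1)).filter fun 𝒜 => ∀ A ∈ 𝒜, Inv s A).card =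
      ((fourFam n k).filter fun 𝒜 => ∀ A ∈ 𝒜, Inv s A).card * (2 ^ (n - 1) - 2 * k).choose 2 := by
  have hn : 0 < n := by
    rcases Nat.eq_zero_or_pos n with rfl | h
    · exact absurd (Subsingleton.elim s 0) h0
    · exact h
  have h1 : (k + 1) * ((fourFam n (k + 1)).filter fun 𝒜 => ∀ A ∈ 𝒜, Inv s A).card =
      (((fourFam n (k + 1)).filter fun 𝒜 => ∀ A ∈ 𝒜, Inv s A).sigma fun 𝒜 => 𝒜).card := by
    rw [card_sigma, sum_const_nat (m := k + 1), mul_comm]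
    intro 𝒜 h
    exact (mem_fourFam.1 (mem_filter.1 h).1).1
  have h2 : ((fourFam n k).filter fun 𝒜 => ∀ A ∈ 𝒜, Inv s A).card *
      (2 ^ (n - 1) - 2 * k).choose 2 =
      (((fourFam n k).filter fun 𝒜 => ∀ A ∈ 𝒜, Inv s A).sigma fun 𝒜 =>
        (((𝒜.biUnion id)ᶜ).powersetCard 4).filter (Inv s)).card := by
    rw [card_sigma, sum_const_nat (m := (2 ^ (n - 1) - 2 * k).choose 2)]
    intro 𝒜 h
    obtain ⟨hF, hI⟩ := mem_filter.1 h
    obtain ⟨hc, h4, hd⟩ := mem_fourFam.1 hF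
    rw [card_inv_four h0]
    · congr 1
      rw [card_compl, card_biUnion (t := id) (fun A hA B hB hAB => hd A hA B hB hAB),
        sum_const_nat (f := fun A => (id A : Finset (V n)).card) (m := 4) h4, hc]
      have : Fintype.card (V n) = 2 * 2 ^ (n - 1) := by
        rw [← pow_succ', Nat.sub_add_cancel hn]
        simp [V]
      rw [this]; omega
    · intro a ha
      simp only [mem_compl, mem_biUnion, id, not_exists, not_and] at ha ⊢
      exact fun A hA h' => ha A hA ((hI A hA).mem_iff.1 h')
  rw [h1, h2]
  refine card_nbij' (fun p => ⟨p.1.erase p.2, p.2⟩) (fun p => ⟨insert p.2 p.1, p.2⟩) ?_ ?_ ?_ ?_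
  · rintro ⟨𝒜, A⟩ h
    simp only [coe_sigma, Set.mem_sigma_iff, mem_coe, mem_filter, mem_fourFam,
      mem_powersetCard] at h ⊢
    obtain ⟨⟨⟨hc, h4, hd⟩, hI⟩, hA⟩ := h
    refine ⟨⟨⟨by rw [card_erase_of_mem hA, hc]; rfl, fun B hB => h4 B (mem_of_mem_erase hB),
      fun B hB C hC => hd B (mem_of_mem_erase hB) C (mem_of_mem_erase hC)⟩,
      fun B hB => hI B (mem_of_mem_erase hB)⟩, ⟨?_, h4 A hA⟩, hI A hA⟩
    intro a ha
    simp only [mem_compl, mem_biUnion, id, not_exists, not_and]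
    intro B hB haB
    exact disjoint_left.1 (hd B (mem_of_mem_erase hB) A hA (ne_of_mem_erase hB)) haB ha
  · rintro ⟨𝒜, A⟩ h
    simp only [coe_sigma, Set.mem_sigma_iff, mem_coe, mem_filter, mem_fourFam,
      mem_powersetCard] at h ⊢
    obtain ⟨⟨⟨hc, h4, hd⟩, hI⟩, ⟨hAs, hA4⟩, hAI⟩ := h
    have hdis : ∀ B ∈ 𝒜, Disjoint B A := by
      intro B hB
      rw [disjoint_left]
      intro a haB haA
      have := hAs haA
      simp only [mem_compl, mem_biUnion, id, not_exists, not_and] at this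
      exact this B hB haB
    have hA : A ∉ 𝒜 := by
      intro h
      have := disjoint_self.1 (hdis A h)
      simp [this] at hA4
    refine ⟨⟨⟨by rw [card_insert_of_notMem hA, hc], ?_, ?_⟩, ?_⟩, mem_insert_self _ _⟩
    · exact forall_mem_insert .. |>.2 ⟨hA4, h4⟩
    · intro B hB C hC hne
      rcases mem_insert.1 hB with rfl | hB <;> rcases mem_insert.1 hC with rfl | hC
      · exact absurd rfl hne
      · exact (hdis C hC).symm
      · exact hdis B (by assumption)
      · exact hd B hB C hC hne
    · exact forall_mem_insert .. |>.2 ⟨hAI, hI⟩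
  · rintro ⟨𝒜, A⟩ h
    simp only [coe_sigma, Set.mem_sigma_iff, mem_coe] at h
    simp [insert_erase h.2]
  · rintro ⟨𝒜, A⟩ h
    simp only [coe_sigma, Set.mem_sigma_iff, mem_coe, mem_filter, mem_powersetCard] at h
    have hA : A ∉ 𝒜 := by
      intro hA
      obtain ⟨a, ha⟩ : A.Nonempty := card_pos.1 (by omega)
      have := h.2.1.1 ha
      simp only [mem_compl, mem_biUnion, id, not_exists, not_and] at this
      exact this A hA ha
    simp [erase_insert hA]

theorem card_invFam {s : V n} (h0 : s ≠ 0) (k : ℕ) :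
    ((fourFam n k).filter fun 𝒜 => ∀ A ∈ 𝒜, Inv s A).card * (2 ^ k * k !) =
      (2 ^ (n - 1)).descFactorial (2 * k) := by
  induction k with
  | zero =>
    have : ((fourFam n 0).filter fun 𝒜 => ∀ A ∈ 𝒜, Inv s A) = {∅} := by
      ext 𝒜
      simp only [mem_filter, mem_fourFam, card_eq_zero, mem_singleton]
      constructor
      · exact fun h => h.1.1
      · rintro rfl; simp
    simp [this]
  | succ k ih =>
    have h := card_invFam_succ h0 k
    set x := ((fourFam n (k + 1)).filter fun 𝒜 => ∀ A ∈ 𝒜, Inv s A).card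
    set y := ((fourFam n k).filter fun 𝒜 => ∀ A ∈ 𝒜, Inv s A).card
    set m := 2 ^ (n - 1)
    have hch : (m - 2 * k).choose 2 * 2 = (m - 2 * k) * (m - 2 * k - 1) := by
      rw [Nat.choose_two_right]
      exact Nat.div_mul_cancel (Nat.even_mul_pred_self _).two_dvd
    calc x * (2 ^ (k + 1) * (k + 1)!) = ((k + 1) * x) * (2 * (2 ^ k * k !)) := by
          rw [Nat.factorial_succ, pow_succ]; ring
      _ = (y * (2 ^ k * k !)) * ((m - 2 * k).choose 2 * 2) := by rw [h]; ring
      _ = _ := by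
        rw [ih, hch, show 2 * (k + 1) = 2 * k + 1 + 1 by ring, Nat.descFactorial_succ,
          Nat.descFactorial_succ, Nat.sub_sub]
        ring

/-- The members must be cosets of the plane spanned by `s` and `t`; distinct cosets are
automatically disjoint. -/
theorem card_parFam {s t : V n} (h0 : s ≠ 0) (h0' : t ≠ 0) (hst : s ≠ t) (k : ℕ) :
    ((fourFam n k).filter fun 𝒜 => (∀ A ∈ 𝒜, Inv s A) ∧ ∀ A ∈ 𝒜, Inv t A).card =
      (2 ^ (n - 2)).choose k := by
  have hQ := card_cosets h0 h0' hst
  have hQ' : ((univ : Finset (V n)).image (plane s t)).card = 2 ^ (n - 2) := by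
    rcases lt_or_ge n 2 with h | h
    -- Here `hQ` would make 1 or 2 a multiple of 4.
    · interval_cases n <;> omega
    · obtain ⟨m, rfl⟩ := Nat.exists_eq_add_of_le' h
      rw [pow_add] at hQ
      simp only [Nat.add_sub_cancel]
      omega
  rw [← hQ', ← card_powersetCard]
  congr 1
  ext 𝒜
  simp only [mem_filter, mem_fourFam, mem_powersetCard]
  constructor
  · rintro ⟨⟨hc, h4, -⟩, hs, ht⟩
    refine ⟨fun A hA => ?_, hc⟩
    obtain ⟨a, ha⟩ : A.Nonempty := card_pos.1 (by rw [h4 A hA]; norm_num)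
    exact mem_image.2 ⟨a, mem_univ _,
      (eq_plane h0 h0' hst (h4 A hA) (hs A hA) (ht A hA) ha).symm⟩
  · rintro ⟨hsub, hc⟩
    have hex : ∀ A ∈ 𝒜, ∃ a, plane s t a = A := fun A hA => by
      obtain ⟨a, -, h⟩ := mem_image.1 (hsub hA)
      exact ⟨a, h⟩
    have h4 : ∀ A ∈ 𝒜, A.card = 4 := fun A hA => by
      obtain ⟨a, rfl⟩ := hex A hA
      exact card_plane h0 h0' hst a
    have hs : ∀ A ∈ 𝒜, Inv s A := fun A hA => by
      obtain ⟨a, rfl⟩ := hex A hA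
      exact inv_plane_left s t a
    have ht : ∀ A ∈ 𝒜, Inv t A := fun A hA => by
      obtain ⟨a, rfl⟩ := hex A hA
      exact inv_plane_right s t a
    refine ⟨⟨hc, h4, fun A hA B hB hne => ?_⟩, hs, ht⟩
    rw [disjoint_left]
    intro x hxA hxB
    exact hne ((eq_plane h0 h0' hst (h4 A hA) (hs A hA) (ht A hA) hxA).trans
      (eq_plane h0 h0' hst (h4 B hB) (hs B hB) (ht B hB) hxB).symm)

theorem card_nonzero : ((univ : Finset (V n)).erase 0).card = 2 ^ n - 1 := by
  rw [card_erase_of_mem (mem_univ _), card_univ]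
  simp [V]

/-- Double counting of pairs of a family and a direction; the sum is `s_n(2k)`. -/
theorem sum_card_dirs (k : ℕ) :
    (∑ 𝒜 ∈ fourFam n k, (dirs 𝒜).card) * (2 ^ k * k !) =
      (2 ^ n - 1) * (2 ^ (n - 1)).descFactorial (2 * k) := by
  have h : ∑ 𝒜 ∈ fourFam n k, (dirs 𝒜).card = ∑ s ∈ (univ : Finset (V n)).erase 0,
      ((fourFam n k).filter fun 𝒜 => ∀ A ∈ 𝒜, Inv s A).card := by
    have := sum_card_bipartiteAbove_eq_sum_card_bipartiteBelow
      (s := (univ : Finset (V n)).erase 0) (t := fourFam n k)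
      (fun (s : V n) (𝒜 : Finset (Finset (V n))) => ∀ A ∈ 𝒜, Inv s A)
    simp only [bipartiteAbove] at this
    rw [this]
    refine sum_congr rfl fun 𝒜 _ => ?_
    congr 1
    ext s
    simp [dirs, bipartiteBelow]
  rw [h, sum_mul, sum_congr rfl fun s hs => card_invFam (ne_of_mem_erase hs) k, sum_const,
    card_nonzero, smul_eq_mul]

/-- Double counting of families with an ordered pair of distinct directions; the value is `2
r_n(2k)`. -/
theorem sum_card_dirs_mul (k : ℕ) :
    ∑ 𝒜 ∈ fourFam n k, (dirs 𝒜).card * ((dirs 𝒜).card - 1) =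
      (2 ^ n - 1) * (2 ^ n - 2) * (2 ^ (n - 2)).choose k := by
  have h : ∑ 𝒜 ∈ fourFam n k, (dirs 𝒜).card * ((dirs 𝒜).card - 1) =
      ∑ p ∈ ((univ : Finset (V n)).erase 0).offDiag,
      ((fourFam n k).filter fun 𝒜 => (∀ A ∈ 𝒜, Inv p.1 A) ∧ ∀ A ∈ 𝒜, Inv p.2 A).card := by
    have := sum_card_bipartiteAbove_eq_sum_card_bipartiteBelow
      (s := ((univ : Finset (V n)).erase 0).offDiag) (t := fourFam n k)
      (fun (p : V n × V n) (𝒜 : Finset (Finset (V n))) =>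
        (∀ A ∈ 𝒜, Inv p.1 A) ∧ ∀ A ∈ 𝒜, Inv p.2 A)
    simp only [bipartiteAbove] at this
    rw [this]
    refine sum_congr rfl fun 𝒜 _ => ?_
    rw [Nat.mul_sub_one, ← offDiag_card]
    congr 1
    ext p
    simp only [mem_offDiag, mem_dirs, bipartiteBelow, mem_filter, mem_erase, mem_univ, and_true]
    tauto
  rw [h, sum_congr rfl fun p hp => ?_, sum_const, offDiag_card, card_nonzero, smul_eq_mul,
    ← Nat.mul_sub_one, Nat.sub_sub]
  obtain ⟨h1, h2, h3⟩ := mem_offDiag.1 hp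
  exact card_parFam (ne_of_mem_erase h1) (ne_of_mem_erase h2) h3 k

/-- A direction sends a fixed point of a four-element member to one of the other three points, which
bounds the number by 3. Two distinct directions bring their sum as a third. -/
theorem card_dirs_cases {k : ℕ} (hk : 0 < k) {𝒜 : Finset (Finset (V n))} (h : 𝒜 ∈ fourFam n k) :
    (dirs 𝒜).card = 0 ∨ (dirs 𝒜).card = 1 ∨ (dirs 𝒜).card = 3 := by
  obtain ⟨hc, h4, -⟩ := mem_fourFam.1 h
  obtain ⟨A, hA⟩ : 𝒜.Nonempty := card_pos.1 (hc ▸ hk)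
  have hA4 := h4 A hA
  obtain ⟨a, ha⟩ : A.Nonempty := card_pos.1 (by omega)
  have hle : (dirs 𝒜).card ≤ 3 := by
    have : (dirs 𝒜).card ≤ (A.erase a).card := by
      refine card_le_card_of_injOn (fun s => a + s) (fun s hs => ?_)
        (fun s _ t _ hst => add_left_cancel hst)
      obtain ⟨h0, hs⟩ := mem_dirs.1 hs
      exact mem_erase.2 ⟨by simpa using h0, hs A hA a ha⟩
    rw [card_erase_of_mem ha, hA4] at this
    exact this
  by_cases h2 : 1 < (dirs 𝒜).card
  · obtain ⟨s, hs, t, ht, hst⟩ := one_lt_card.1 h2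
    obtain ⟨hs0, hs'⟩ := mem_dirs.1 hs
    obtain ⟨ht0, ht'⟩ := mem_dirs.1 ht
    have h3 : s + t ∈ dirs 𝒜 := by
      refine mem_dirs.2 ⟨fun h => hst ?_, fun A hA => (hs' A hA).add (ht' A hA)⟩
      rw [add_eq_iff_vec] at h
      rw [h, zero_add]
    have : ({s, t, s + t} : Finset (V n)) ⊆ dirs 𝒜 := by
      intro x hx
      simp only [mem_insert, mem_singleton] at hx
      rcases hx with rfl | rfl | rfl <;> assumption
    have hc3 : ({s, t, s + t} : Finset (V n)).card = 3 := by
      rw [card_eq_three]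
      exact ⟨s, t, s + t, hst, by simpa using ht0, by simpa using hs0, rfl⟩
    have := card_le_card this
    omega
  · omega

/-- The families with a common nonzero invariant translation. -/
noncomputable def dirFam (n k : ℕ) : Finset (Finset (Finset (V n))) :=
  (fourFam n k).filter fun 𝒜 => (dirs 𝒜).Nonempty

/-- For `x = 0, 1, 3`, the number `3x - x(x-1)` is 3 if `x > 0` and 0 otherwise. -/
theorem sum_card_dirs_eq {k : ℕ} (hk : 0 < k) :
    3 * ∑ 𝒜 ∈ fourFam n k, (dirs 𝒜).card =
      3 * (dirFam n k).card + (2 ^ n - 1) * (2 ^ n - 2) * (2 ^ (n - 2)).choose k := by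
  rw [← sum_card_dirs_mul, dirFam, card_filter, mul_sum, mul_sum, ← sum_add_distrib]
  refine sum_congr rfl fun 𝒜 h => ?_
  simp only [← card_pos]
  rcases card_dirs_cases hk h with h | h | h <;> simp [h]

end Translations

/-! ### Counting the sign arrays with translation-invariant support -/

section Core
variable {n : ℕ}

/-- The nonzero elements of `M` are preserved by the translation of the rows by `s`. -/
def RowInv {β : Type*} (s : V n) (M : V n → β → SignType) : Prop :=
  ∀ a b, M (a + s) b = 0 ↔ M a b = 0

instance {β : Type*} [Fintype β] (s : V n) (M : V n → β → SignType) : Decidable (RowInv s M) := by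
  unfold RowInv; infer_instance

/-- The nonzero translations of rows preserving the support. -/
def rowDirs {β : Type*} [Fintype β] (M : V n → β → SignType) : Finset (V n) :=
  univ.filter fun s => s ≠ 0 ∧ RowInv s M

/-- The nonzero translations of columns preserving the support. -/
def colDirs {α : Type*} [Fintype α] (M : α → V n → SignType) : Finset (V n) :=
  rowDirs fun b a => M a b

theorem mem_rowDirs {β : Type*} [Fintype β] {M : V n → β → SignType} {s : V n} :
    s ∈ rowDirs M ↔ s ≠ 0 ∧ RowInv s M := by simp [rowDirs]

theorem mem_colDirs {α : Type*} [Fintype α] {M : α → V n → SignType} {s : V n} :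
    s ∈ colDirs M ↔ s ≠ 0 ∧ RowInv s (fun b a => M a b) := mem_rowDirs

open Classical in
/-- The arrays with `2d` nonzero rows whose nonzero lines have four elements with product `-1`. -/
noncomputable def baseArrays (n d : ℕ) : Finset (V n → V n → SignType) :=
  univ.filter fun M => IsSignArray 4 M ∧ (rowSet M).card = 2 * d

theorem mem_baseArrays {d : ℕ} {M : V n → V n → SignType} :
    M ∈ baseArrays n d ↔ IsSignArray 4 M ∧ (rowSet M).card = 2 * d := by
  classical
  rw [baseArrays, mem_filter]
  simp

/-- The base arrays whose support is invariant under nonzero translations of rows and columns. -/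
noncomputable def coreArrays (n d : ℕ) : Finset (V n → V n → SignType) :=
  (baseArrays n d).filter fun M => (rowDirs M).Nonempty ∧ (colDirs M).Nonempty

/-- If `s i = 1`, the hyperplane `a i = 0` meets each orbit `{a, a + s}` once; the Boolean
coordinate tells the two points of an orbit apart. -/
theorem exists_equiv_translation {s : V n} (h0 : s ≠ 0) :
    ∃ e : Fin (2 ^ (n - 1)) × Bool ≃ V n, ∀ c, e (c, true) = e (c, false) + s := by
  obtain ⟨i, hi⟩ := Function.ne_iff.1 h0
  have hs : s i = 1 := Fin.eq_one_of_ne_zero _ hi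
  have hn : 0 < n := i.pos
  have hc : 2 ^ n = 2 * (univ.filter fun a : V n => a i = 0).card := by
    rw [← card_filter_half hi (A := univ) fun a _ => mem_univ _, card_univ]
    simp [V]
  have hc' : Fintype.card {a : V n // a i = 0} = 2 ^ (n - 1) := by
    rw [Fintype.card_subtype]
    have : 2 ^ n = 2 * 2 ^ (n - 1) := by rw [← pow_succ', Nat.sub_add_cancel hn]
    omega
  let g := (Fintype.equivFinOfCardEq hc').symm
  let f : Fin (2 ^ (n - 1)) × Bool → V n := fun p => (g p.1 : V n) + if p.2 then s else 0
  have hcoord : ∀ p, f p i = if p.2 then 1 else 0 := by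
    rintro ⟨c, x⟩
    have := (g c).2
    cases x <;> simp [f, this, hs]
  have hf : Function.Injective f := by
    rintro ⟨c, x⟩ ⟨c', x'⟩ h
    have h1 := hcoord (c, x)
    rw [h, hcoord] at h1
    have hx : x = x' := by
      cases x <;> cases x' <;> simp at h1 ⊢
    subst hx
    have : g c = g c' := Subtype.ext (add_right_cancel h)
    rw [g.injective this]
  refine ⟨Equiv.ofBijective f ((Fintype.bijective_iff_injective_and_card f).2 ⟨hf, ?_⟩),
    fun c => ?_⟩
  · simp only [Fintype.card_prod, Fintype.card_fin, Fintype.card_bool]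
    rw [← pow_succ, Nat.sub_add_cancel hn]
    simp [V]
  · simp [f]

theorem isSignArray_comp_equiv {α β γ δ : Type*} [Fintype α] [Fintype β] [Fintype γ] [Fintype δ]
    (e : γ ≃ α) (f : δ ≃ β) {k : ℕ} {M : α → β → SignType} :
    IsSignArray k (fun c d => M (e c) (f d)) ↔ IsSignArray k M := by
  refine and_congr ?_ ?_
  · rw [← e.forall_congr_right]
    exact forall_congr' fun c => isLine_comp_equiv f
  · rw [← f.forall_congr_right]
    exact forall_congr' fun d => isLine_comp_equiv (f := fun a => M a (f d)) e

theorem card_rowSet_comp_equiv {α β γ δ : Type*} [Fintype α] [Fintype β] [Fintype γ] [Fintype δ]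
    (e : γ ≃ α) (f : δ ≃ β) {M : α → β → SignType} :
    (rowSet fun c d => M (e c) (f d)).card = (rowSet M).card := by
  rw [← card_map e.toEmbedding]
  congr 1
  ext a
  rw [mem_map, mem_rowSet]
  constructor
  · rintro ⟨c, hc, rfl⟩
    obtain ⟨d, hd⟩ := mem_rowSet.1 hc
    exact ⟨f d, hd⟩
  · rintro ⟨b, hb⟩
    exact ⟨e.symm a, mem_rowSet.2 ⟨f.symm b, by simpa using hb⟩, by simp⟩

theorem rowInv_iff {β : Type*} {s : V n} {ι : Type*} (e : ι × Bool ≃ V n)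
    (he : ∀ c, e (c, true) = e (c, false) + s) {M : V n → β → SignType} :
    RowInv s M ↔ ∀ c x b, M (e (c, x)) b = 0 ↔ M (e (c, false)) b = 0 := by
  constructor
  · intro h c x b
    cases x
    · rfl
    · rw [he, h]
  · intro h a b
    obtain ⟨⟨c, x⟩, rfl⟩ := e.surjective a
    cases x
    · rw [← he, h]
    · rw [he, add_add_self_vec, ← he, h c true]

/-- In coordinates adapted to `s` and `t`, invariance of the support means that it is a union of
full blocks of order two. -/
theorem card_invArrays {d : ℕ} {s t : V n} (hs : s ≠ 0) (ht : t ≠ 0) :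
    ((baseArrays n d).filter fun M => RowInv s M ∧ RowInv t fun b a => M a b).card =
      2 ^ (4 * d) * ((2 ^ (n - 1)).choose d *
        ((2 ^ (n - 1)).descFactorial d * numDerangements d)) := by
  obtain ⟨e, he⟩ := exists_equiv_translation hs
  obtain ⟨f, hf⟩ := exists_equiv_translation ht
  have h := card_blockArrays (α := Fin (2 ^ (n - 1))) (β := Fin (2 ^ (n - 1))) d
  rw [card_twoArrays, Fintype.card_fin] at h
  rw [← h]
  have key : ∀ M : V n → V n → SignType,
      (M ∈ baseArrays n d ∧ RowInv s M ∧ RowInv t fun b a => M a b) ↔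
      (fun c d => M (e c) (f d)) ∈
        blockArrays (Fin (2 ^ (n - 1))) (Fin (2 ^ (n - 1))) d := by
    intro M
    rw [mem_blockArrays, mem_baseArrays, isSignArray_comp_equiv e f, card_rowSet_comp_equiv e f,
      and_assoc, rowInv_iff e he, rowInv_iff f hf]
    refine and_congr_right fun _ => and_congr_right fun _ => ⟨?_, ?_⟩
    · rintro ⟨h1, h2⟩ a x b y
      rw [h1, h2]
    · intro h
      refine ⟨fun c x b => ?_, fun c x b => ?_⟩
      · obtain ⟨⟨b, y⟩, rfl⟩ := f.surjective b
        rw [h, h c false b y]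
      · obtain ⟨⟨b, y⟩, rfl⟩ := e.surjective b
        rw [h, h b y c false]
  refine card_bij' (fun M _ c d => M (e c) (f d)) (fun M _ a b => M (e.symm a) (f.symm b))
    ?_ ?_ ?_ ?_
  · intro M hM
    exact (key M).1 (mem_filter.1 hM)
  · intro M hM
    refine mem_filter.2 ((key _).2 ?_)
    simpa using hM
  · intro M _; funext a b; simp
  · intro M _; funext a b; simp

/-- Double counting of triples `(M, s, t)`. This is the main term: core arrays counted with
multiplicity, other arrays with weight 0. -/
theorem sum_card_dirs_arrays (d : ℕ) :
    ∑ M ∈ baseArrays n d, (rowDirs M).card * (colDirs M).card =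
      (2 ^ n - 1) ^ 2 * (2 ^ (4 * d) * ((2 ^ (n - 1)).choose d *
        ((2 ^ (n - 1)).descFactorial d * numDerangements d))) := by
  have := sum_card_bipartiteAbove_eq_sum_card_bipartiteBelow
    (s := ((univ : Finset (V n)).erase 0) ×ˢ ((univ : Finset (V n)).erase 0))
    (t := baseArrays n d)
    (fun (p : V n × V n) (M : V n → V n → SignType) =>
      RowInv p.1 M ∧ RowInv p.2 fun b a => M a b)
  simp only [bipartiteAbove] at this
  rw [sum_congr rfl fun p hp => card_invArrays (ne_of_mem_erase (mem_product.1 hp).1)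
    (ne_of_mem_erase (mem_product.1 hp).2), sum_const, card_product, card_nonzero, smul_eq_mul,
    ← sq] at this
  rw [this]
  refine sum_congr rfl fun M _ => ?_
  rw [← card_product]
  congr 1
  ext p
  simp only [mem_product, mem_rowDirs, mem_colDirs, bipartiteBelow, mem_filter, mem_erase,
    mem_univ, and_true]
  tauto

/-- The rows of the support are pairwise equal or disjoint. -/
def RectClosed {α β : Type*} (M : α → β → SignType) : Prop :=
  ∀ a a' b b', M a b ≠ 0 → M a' b ≠ 0 → M a b' ≠ 0 → M a' b' ≠ 0

theorem RectClosed.transpose {α β : Type*} {M : α → β → SignType} (h : RectClosed M) :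
    RectClosed fun b a => M a b := fun b b' a a' h1 h2 h3 => h a a' b b' h1 h3 h2

theorem rectClosed_transpose {α β : Type*} {M : α → β → SignType} :
    (RectClosed fun b a => M a b) ↔ RectClosed M :=
  ⟨fun h => h.transpose, fun h => h.transpose⟩

/-- Two distinct column directions make every nonzero row support a coset of the plane they span,
and cosets of one plane are equal or disjoint. -/
theorem card_colDirs_le_one {α : Type*} [Fintype α] {M : α → V n → SignType}
    (hM : ∀ a, IsLine 4 (M a)) (h : ¬ RectClosed M) : (colDirs M).card ≤ 1 := by
  rw [card_le_one]
  intro s hs t ht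
  by_contra hst
  obtain ⟨hs0, hs⟩ := mem_colDirs.1 hs
  obtain ⟨ht0, ht⟩ := mem_colDirs.1 ht
  apply h
  intro a a' b b' h1 h2 h3
  have hinv : ∀ a u, RowInv u (fun b a => M a b) → Inv u (supp (M a)) := by
    intro a u hu b hb
    rw [mem_supp] at hb ⊢
    rwa [Ne, hu b a]
  have hS := eq_plane hs0 ht0 hst ((hM a).card_supp h1) (hinv a s hs) (hinv a t ht)
    (mem_supp.2 h1)
  have hS' := eq_plane hs0 ht0 hst ((hM a').card_supp h2) (hinv a' s hs) (hinv a' t ht)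
    (mem_supp.2 h2)
  rw [← mem_supp, hS', ← hS, mem_supp]
  exact h3

theorem card_core_not_rect (d : ℕ) [DecidablePred fun M : V n → V n → SignType => RectClosed M] :
    ∑ M ∈ (baseArrays n d).filter fun M => ¬ RectClosed M, (rowDirs M).card * (colDirs M).card =
      ((coreArrays n d).filter fun M => ¬ RectClosed M).card := by
  rw [coreArrays, filter_filter, card_filter, sum_filter]
  refine sum_congr rfl fun M hM => ?_
  by_cases h : RectClosed M
  · simp [h]
  · obtain ⟨h1, -⟩ := mem_baseArrays.1 hM
    have hc := card_colDirs_le_one h1.1 h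
    have hr : (rowDirs M).card ≤ 1 :=
      card_colDirs_le_one (M := fun b a => M a b) h1.2 (mt rectClosed_transpose.1 h)
    simp only [h, not_false_eq_true, if_true, and_true, ← card_pos]
    generalize (rowDirs M).card = x at *
    generalize (colDirs M).card = y at *
    interval_cases x <;> interval_cases y <;> simp

/-- Outside `RectClosed` the multiplicity is 0 or 1, so only these arrays need a correction. Terms
are moved across the equality to avoid truncated subtraction. -/
theorem card_core_add (d : ℕ) [DecidablePred fun M : V n → V n → SignType => RectClosed M] :
    (coreArrays n d).card + ∑ M ∈ (baseArrays n d).filter fun M => RectClosed M,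
        (rowDirs M).card * (colDirs M).card =
      (2 ^ n - 1) ^ 2 * (2 ^ (4 * d) * ((2 ^ (n - 1)).choose d *
        ((2 ^ (n - 1)).descFactorial d * numDerangements d))) +
      ((coreArrays n d).filter fun M => RectClosed M).card := by
  have h := card_core_not_rect (n := n) d
  have h1 := sum_filter_add_sum_filter_not (baseArrays n d) (fun M => RectClosed M)
    fun M => (rowDirs M).card * (colDirs M).card
  rw [sum_card_dirs_arrays] at h1
  have h2 := card_filter_add_card_filter_not (s := coreArrays n d) fun M => RectClosed M
  omega

end Core

/-! ### Arrays with pairwise equal or disjoint row supports, as block permutations -/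

section Families
variable {α β : Type*} [Fintype α] [Fintype β] [DecidableEq α] [DecidableEq β]

/-- The set of supports of nonzero rows. -/
def rowFam (M : α → β → SignType) : Finset (Finset β) := (rowSet M).image fun a => supp (M a)

/-- The set of supports of nonzero columns. -/
def colFam (M : α → β → SignType) : Finset (Finset α) := rowFam fun b a => M a b

theorem mem_rowFam {M : α → β → SignType} {B : Finset β} :
    B ∈ rowFam M ↔ ∃ a, (∃ b, M a b ≠ 0) ∧ supp (M a) = B := by
  simp only [rowFam, mem_image, mem_rowSet]

theorem mem_colFam {M : α → β → SignType} {A : Finset α} :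
    A ∈ colFam M ↔ ∃ b, (∃ a, M a b ≠ 0) ∧ (supp fun a => M a b) = A := mem_rowFam

/-- The arrays with given families of supports of rows and columns are the block permutations. -/
theorem exists_isBlockPerm {𝒜 : Finset (Finset α)} {ℬ : Finset (Finset β)}
    (hcard : 𝒜.card = ℬ.card) (hd : ∀ A ∈ 𝒜, ∀ B ∈ 𝒜, A ≠ B → Disjoint A B)
    {M : α → β → SignType} (hM : IsSignArray 4 M) (hR : RectClosed M)
    (h𝒜 : colFam M = 𝒜) (hℬ : rowFam M = ℬ) :
    ∃ π, IsBlockPerm (fun A : 𝒜 => (A : Finset α))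
      (fun (A : 𝒜) (B : ℬ) => fullBlocks (A : Finset α) (B : Finset β)) π M := by
  have hex : ∀ A : 𝒜, ∃ b, (∃ a, M a b ≠ 0) ∧ (supp fun a => M a b) = A := fun A =>
    mem_colFam.1 (h𝒜 ▸ A.2)
  choose c hc hcA using hex
  choose r hr using hc
  have hmem : ∀ (A : 𝒜) a, a ∈ (A : Finset α) ↔ M a (c A) ≠ 0 := fun A a => by
    rw [← hcA A, mem_supp]
  have hB : ∀ A : 𝒜, supp (M (r A)) ∈ ℬ := fun A =>
    hℬ ▸ mem_rowFam.2 ⟨r A, ⟨_, hr A⟩, rfl⟩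
  -- By `RectClosed` all rows in `A` have the same support, so a representative row `r A` determines
  -- the block belonging to `A`.
  let g : 𝒜 → ℬ := fun A => ⟨supp (M (r A)), hB A⟩
  have hg : Function.Injective g := by
    intro A A' h
    have h1 : supp (M (r A)) = supp (M (r A')) := congrArg Subtype.val h
    by_contra hne
    have h2 : r A' ∈ (A : Finset α) := by
      rw [hmem, ← mem_supp, ← h1, mem_supp]
      exact hr A
    exact disjoint_left.1 (hd A A.2 A' A'.2 fun e => hne (Subtype.ext e)) h2 ((hmem _ _).2 (hr A'))
  have hsupp : ∀ (A : 𝒜) a, a ∈ (A : Finset α) → ∀ b, M a b ≠ 0 ↔ M (r A) b ≠ 0 := by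
    intro A a ha b
    rw [hmem] at ha
    exact ⟨fun h => hR _ _ _ _ ha (hr A) h, fun h => hR _ _ _ _ (hr A) ha h⟩
  refine ⟨Equiv.ofBijective g ((Fintype.bijective_iff_injective_and_card g).2
    ⟨hg, by simpa using hcard⟩), fun A => ?_, fun a ha => ?_⟩
  · rw [mem_fullBlocks]
    refine ⟨fun a b => ?_, fun a => ?_, fun b => ?_⟩
    · simp only [restrictRows, Equiv.ofBijective_apply, g, mem_supp]
      by_cases ha : a ∈ (A : Finset α)
      · simp only [ha, if_true, true_and]
        exact hsupp A a ha b
      · simp [ha]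
    · by_cases ha : a ∈ (A : Finset α)
      · have : restrictRows (A : Finset α) M a = M a := by funext b; simp [restrictRows, ha]
        rw [this]
        exact hM.1 a
      · exact Or.inl (funext fun b => by simp [restrictRows, ha])
    · by_cases hb : M (r A) b ≠ 0
      · have : (fun a => restrictRows (A : Finset α) M a b) = fun a => M a b := by
          funext a
          simp only [restrictRows]
          split_ifs with ha
          · rfl
          · by_contra h
            exact ha ((hmem A a).2 (hR _ _ _ _ hb (Ne.symm h) (hr A)))
        rw [this]
        exact hM.2 b
      · refine Or.inl (funext fun a => ?_)
        simp only [restrictRows]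
        split_ifs with ha
        · by_contra h
          exact hb ((hsupp A a ha b).1 h)
        · rfl
  · funext b
    by_contra h
    exact ha ⟨_, h𝒜 ▸ mem_colFam.2 ⟨b, ⟨a, h⟩, rfl⟩⟩ (mem_supp.2 h)

/-- The converse of `exists_isBlockPerm`: by disjointness a nonzero line lives in a single block and
inherits its line condition. Nonemptiness of the members lets both families be recovered from the
array. -/
theorem isSignArray_of_isBlockPerm {𝒜 : Finset (Finset α)} {ℬ : Finset (Finset β)}
    (hd : ∀ A ∈ 𝒜, ∀ B ∈ 𝒜, A ≠ B → Disjoint A B) (hd' : ∀ A ∈ ℬ, ∀ B ∈ ℬ, A ≠ B → Disjoint A B)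
    (hA0 : ∀ A ∈ 𝒜, A.Nonempty) (hB0 : ∀ B ∈ ℬ, B.Nonempty)
    {M : α → β → SignType} {π : 𝒜 ≃ ℬ} (h : IsBlockPerm (fun A : 𝒜 => (A : Finset α))
      (fun (A : 𝒜) (B : ℬ) => fullBlocks (A : Finset α) (B : Finset β)) π M) :
    IsSignArray 4 M ∧ RectClosed M ∧ rowSet M = 𝒜.biUnion id ∧ colFam M = 𝒜 ∧ rowFam M = ℬ := by
  obtain ⟨h1, h2⟩ := h
  have hu : ∀ (A A' : 𝒜) a, a ∈ (A : Finset α) → a ∈ (A' : Finset α) → A = A' := by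
    intro A A' a ha ha'
    by_contra hne
    exact disjoint_left.1 (hd A A.2 A' A'.2 fun e => hne (Subtype.ext e)) ha ha'
  have hu' : ∀ (A A' : 𝒜) b, b ∈ (π A : Finset β) → b ∈ (π A' : Finset β) → A = A' := by
    intro A A' b hb hb'
    by_contra hne
    exact disjoint_left.1 (hd' (π A) (π A).2 (π A') (π A').2
      fun e => hne (π.injective (Subtype.ext e))) hb hb'
  have hex : ∀ a b, M a b ≠ 0 → ∃ A : 𝒜, a ∈ (A : Finset α) := by
    intro a b hab
    by_contra hne
    push Not at hne
    exact hab (congrFun (h2 a hne) b)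
  have hrow : ∀ (A : 𝒜) a, a ∈ (A : Finset α) → ∀ b, M a b ≠ 0 ↔ b ∈ (π A : Finset β) := by
    intro A a ha b
    have := (mem_fullBlocks.1 (h1 A)).1 a b
    simpa [restrictRows, ha] using this
  have hcol : ∀ (A : 𝒜) b, b ∈ (π A : Finset β) → ∀ a, M a b ≠ 0 ↔ a ∈ (A : Finset α) := by
    intro A b hb a
    constructor
    · intro hab
      obtain ⟨A', hA'⟩ := hex a b hab
      rw [hu' A A' b hb ((hrow A' a hA' b).1 hab)]
      exact hA'
    · intro ha
      exact (hrow A a ha b).2 hb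
  have hex' : ∀ a b, M a b ≠ 0 → ∃ A : 𝒜, a ∈ (A : Finset α) ∧ b ∈ (π A : Finset β) := by
    intro a b hab
    obtain ⟨A, hA⟩ := hex a b hab
    exact ⟨A, hA, (hrow A a hA b).1 hab⟩
  refine ⟨⟨fun a => ?_, fun b => ?_⟩, ?_, ?_, ?_, ?_⟩
  · by_cases ha : ∃ A : 𝒜, a ∈ (A : Finset α)
    · obtain ⟨A, hA⟩ := ha
      have : M a = restrictRows (A : Finset α) M a := by funext b; simp [restrictRows, hA]
      rw [this]
      exact (mem_fullBlocks.1 (h1 A)).2.1 a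
    · push Not at ha
      exact Or.inl (h2 a ha)
  · by_cases hb : ∃ A : 𝒜, b ∈ (π A : Finset β)
    · obtain ⟨A, hA⟩ := hb
      have : (fun a => M a b) = fun a => restrictRows (A : Finset α) M a b := by
        funext a
        simp only [restrictRows]
        split_ifs with ha
        · rfl
        · by_contra h'
          exact ha ((hcol A b hA a).1 h')
      rw [this]
      exact (mem_fullBlocks.1 (h1 A)).2.2 b
    · refine Or.inl (funext fun a => ?_)
      by_contra h'
      obtain ⟨A, -, hA⟩ := hex' a b h'
      exact hb ⟨A, hA⟩
  · intro a a' b b' e1 e2 e3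
    obtain ⟨A, hA, hb⟩ := hex' a b e1
    rw [hcol A b hb] at e2
    rw [hrow A a hA] at e3
    exact (hrow A a' e2 b').2 e3
  · ext a
    simp only [mem_rowSet, mem_biUnion, id]
    constructor
    · rintro ⟨b, hb⟩
      obtain ⟨A, hA⟩ := hex a b hb
      exact ⟨A, A.2, hA⟩
    · rintro ⟨A, hA, ha⟩
      obtain ⟨b, hb⟩ := hB0 _ (π ⟨A, hA⟩).2
      exact ⟨b, (hrow ⟨A, hA⟩ a ha b).2 hb⟩
  · ext A
    rw [mem_colFam]
    constructor
    · rintro ⟨b, ⟨a, hab⟩, rfl⟩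
      obtain ⟨A, hA, hb⟩ := hex' a b hab
      have : (supp fun a => M a b) = A := by ext a; rw [mem_supp, hcol A b hb]
      rw [this]
      exact A.2
    · intro hA
      obtain ⟨a, ha⟩ := hA0 A hA
      obtain ⟨b, hb⟩ := hB0 _ (π ⟨A, hA⟩).2
      exact ⟨b, ⟨a, (hcol ⟨A, hA⟩ b hb a).2 ha⟩, by ext a; rw [mem_supp, hcol ⟨A, hA⟩ b hb]⟩
  · ext B
    rw [mem_rowFam]
    constructor
    · rintro ⟨a, ⟨b, hab⟩, rfl⟩
      obtain ⟨A, hA, hb⟩ := hex' a b hab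
      have : supp (M a) = π A := by ext b; rw [mem_supp, hrow A a hA]
      rw [this]
      exact (π A).2
    · intro hB
      obtain ⟨b, hb⟩ := hB0 B hB
      obtain ⟨a, ha⟩ := hA0 _ (π.symm ⟨B, hB⟩).2
      have key := hrow _ a ha
      simp only [Equiv.apply_symm_apply] at key
      exact ⟨a, ⟨b, (key b).2 hb⟩, by ext b; rw [mem_supp, key]⟩

/-- The distinct row supports partition the set of nonzero columns, which is as large as the set of
nonzero rows. -/
theorem rowFam_spec {M : α → β → SignType} (hM : IsSignArray 4 M) (hR : RectClosed M) :
    (∀ B ∈ rowFam M, B.card = 4) ∧ (∀ A ∈ rowFam M, ∀ B ∈ rowFam M, A ≠ B → Disjoint A B) ∧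
      4 * (rowFam M).card = (rowSet M).card := by
  have h4 : ∀ B ∈ rowFam M, B.card = 4 := by
    intro B hB
    obtain ⟨a, ⟨b, hb⟩, rfl⟩ := mem_rowFam.1 hB
    exact (hM.1 a).card_supp hb
  have hd : ∀ A ∈ rowFam M, ∀ B ∈ rowFam M, A ≠ B → Disjoint A B := by
    intro A hA B hB hne
    obtain ⟨a, -, rfl⟩ := mem_rowFam.1 hA
    obtain ⟨a', -, rfl⟩ := mem_rowFam.1 hB
    rw [disjoint_left]
    intro b hb hb'
    rw [mem_supp] at hb hb'
    apply hne
    ext c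
    rw [mem_supp, mem_supp]
    exact ⟨fun h => hR _ _ _ _ hb hb' h, fun h => hR _ _ _ _ hb' hb h⟩
  refine ⟨h4, hd, ?_⟩
  have h : (rowFam M).biUnion id = rowSet fun b a => M a b := by
    ext b
    simp only [mem_biUnion, mem_rowFam, id, mem_rowSet]
    constructor
    · rintro ⟨_, ⟨a, -, rfl⟩, hb⟩
      exact ⟨a, mem_supp.1 hb⟩
    · rintro ⟨a, hab⟩
      exact ⟨_, ⟨a, ⟨b, hab⟩, rfl⟩, mem_supp.2 hab⟩
  rw [← card_rowSet_transpose (by norm_num) hM, ← h,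
    card_biUnion (t := id) fun A hA B hB hAB => hd A hA B hB hAB,
    sum_const_nat (f := fun A => (id A : Finset β).card) h4, mul_comm]

end Families

/-! ### Counting the arrays with pairwise equal or disjoint row supports -/

section RectCount
variable {n : ℕ}

/-- A column translation preserves the support exactly when it preserves each row support. Hence
multiplicities depend on the two families alone. -/
theorem colDirs_eq_dirs {α : Type*} [Fintype α] [DecidableEq α] (M : α → V n → SignType) :
    colDirs M = dirs (rowFam M) := by
  ext s
  rw [mem_colDirs, mem_dirs]
  refine and_congr_right fun _ => ⟨?_, ?_⟩
  · intro h B hB b hb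
    obtain ⟨a, -, rfl⟩ := mem_rowFam.1 hB
    rw [mem_supp] at hb ⊢
    rwa [Ne, h b a]
  · intro h b a
    have key : ∀ b, M a b ≠ 0 → M a (b + s) ≠ 0 := by
      intro b hb
      rw [← mem_supp]
      exact h _ (mem_rowFam.2 ⟨a, ⟨b, hb⟩, rfl⟩) _ (mem_supp.2 hb)
    rw [← not_iff_not]
    refine ⟨fun h' => ?_, key b⟩
    have := key _ h'
    rwa [add_add_self_vec] at this

theorem card_rect_fiber {k : ℕ} {𝒜 ℬ : Finset (Finset (V n))} (hA : 𝒜 ∈ fourFam n k)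
    (hB : ℬ ∈ fourFam n k) [DecidablePred fun M : V n → V n → SignType => RectClosed M] :
    (((baseArrays n (2 * k)).filter fun M => RectClosed M).filter fun M =>
      (colFam M, rowFam M) = (𝒜, ℬ)).card = k ! * 512 ^ k := by
  classical
  obtain ⟨hc, h4, hd⟩ := mem_fourFam.1 hA
  obtain ⟨hc', h4', hd'⟩ := mem_fourFam.1 hB
  have hA0 : ∀ A ∈ 𝒜, A.Nonempty := fun A hA => card_pos.1 (by rw [h4 A hA]; norm_num)
  have hB0 : ∀ A ∈ ℬ, A.Nonempty := fun A hA => card_pos.1 (by rw [h4' A hA]; norm_num)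
  have key := card_blockPerm (A := fun A : 𝒜 => (A : Finset (V n)))
    (B := fun B : ℬ => (B : Finset (V n))) (fun A => hA0 A A.2)
    (fun A A' hne => hd A A.2 A' A'.2 fun e => hne (Subtype.ext e)) Subtype.val_injective
    (P := fun A B => fullBlocks (A : Finset (V n)) (B : Finset (V n)))
    (fun A B N hN => (mem_fullBlocks.1 hN).1)
    (fun A B => card_fullBlocks (h4 A A.2) (h4' B B.2)) (by simp [hc, hc'])
  rw [Fintype.card_coe, hc] at key
  rw [← key]
  congr 1
  ext M
  simp only [mem_filter, mem_univ, true_and, mem_baseArrays, Prod.mk.injEq]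
  constructor
  · rintro ⟨⟨⟨h1, -⟩, h2⟩, h3, h5⟩
    exact exists_isBlockPerm (hc.trans hc'.symm) hd h1 h2 h3 h5
  · rintro ⟨π, hπ⟩
    obtain ⟨h1, h2, h3, h5, h6⟩ := isSignArray_of_isBlockPerm hd hd' hA0 hB0 hπ
    refine ⟨⟨⟨h1, ?_⟩, h2⟩, h5, h6⟩
    rw [h3, card_biUnion (t := id) fun A hA B hB hAB => hd A hA B hB hAB,
      sum_const_nat (f := fun A => (id A : Finset (V n)).card) h4, hc]
    ring

theorem fam_mem_of_rect {d : ℕ} {M : V n → V n → SignType}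
    (hM : M ∈ baseArrays n d) (hR : RectClosed M) :
    4 * (colFam M).card = 2 * d ∧ (colFam M, rowFam M) ∈
      fourFam n (d / 2) ×ˢ fourFam n (d / 2) := by
  obtain ⟨h1, h2⟩ := mem_baseArrays.1 hM
  obtain ⟨a1, a2, a3⟩ := rowFam_spec h1 hR
  obtain ⟨b1, b2, b3⟩ := rowFam_spec h1.transpose hR.transpose
  rw [card_rowSet_transpose (by norm_num) h1] at b3
  refine ⟨b3.trans h2, mem_product.2 ⟨mem_fourFam.2 ⟨?_, b1, b2⟩, mem_fourFam.2 ⟨?_, a1, a2⟩⟩⟩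
  · show (rowFam fun b a => M a b).card = _
    omega
  · show (rowFam M).card = _
    omega

/-- Every pair of families arises from the same number of arrays, so the sum factors. It is applied
with `f` the number of directions and with `f` the indicator of having one. -/
theorem sum_rect (k : ℕ) [DecidablePred fun M : V n → V n → SignType => RectClosed M]
    (f : Finset (Finset (V n)) → ℕ) :
    ∑ M ∈ (baseArrays n (2 * k)).filter fun M => RectClosed M, f (colFam M) * f (rowFam M) =
      (∑ 𝒜 ∈ fourFam n k, f 𝒜) ^ 2 * (k ! * 512 ^ k) := by
  rw [← sum_fiberwise_of_maps_to (t := fourFam n k ×ˢ fourFam n k)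
    (g := fun M => (colFam M, rowFam M))]
  · rw [sq, sum_mul_sum, ← sum_product', sum_mul]
    refine sum_congr rfl fun p hp => ?_
    obtain ⟨hA, hB⟩ := mem_product.1 hp
    rw [sum_congr rfl (g := fun _ => f p.1 * f p.2), sum_const, card_rect_fiber hA hB, smul_eq_mul,
      mul_comm]
    intro M hM
    have := (mem_filter.1 hM).2
    rw [← this]
  · intro M hM
    obtain ⟨h1, h2⟩ := mem_filter.1 hM
    have := (fam_mem_of_rect h1 h2).2
    rwa [Nat.mul_div_cancel_left k two_pos] at this

theorem sum_dirs_rect (k : ℕ) [DecidablePred fun M : V n → V n → SignType => RectClosed M] :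
    ∑ M ∈ (baseArrays n (2 * k)).filter fun M => RectClosed M,
        (rowDirs M).card * (colDirs M).card =
      (∑ 𝒜 ∈ fourFam n k, (dirs 𝒜).card) ^ 2 * (k ! * 512 ^ k) := by
  rw [← sum_rect k fun 𝒜 => (dirs 𝒜).card]
  refine sum_congr rfl fun M _ => ?_
  rw [← colDirs_eq_dirs, colFam, ← colDirs_eq_dirs]
  rfl

theorem card_core_rect (k : ℕ) [DecidablePred fun M : V n → V n → SignType => RectClosed M] :
    ((coreArrays n (2 * k)).filter fun M => RectClosed M).card =
      (dirFam n k).card ^ 2 * (k ! * 512 ^ k) := by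
  rw [dirFam, card_filter (fun 𝒜 : Finset (Finset (V n)) => (dirs 𝒜).Nonempty),
    ← sum_rect k, coreArrays, filter_comm, card_filter]
  refine sum_congr rfl fun M _ => ?_
  have h1 : rowDirs M = dirs (colFam M) := colDirs_eq_dirs fun b a => M a b
  rw [← h1, ← colDirs_eq_dirs]
  by_cases h1 : (rowDirs M).Nonempty <;> by_cases h2 : (colDirs M).Nonempty <;> simp [h1, h2]

theorem rect_filter_eq_empty {d : ℕ} (hd : ¬ Even d)
    [DecidablePred fun M : V n → V n → SignType => RectClosed M] :
    (baseArrays n d).filter (fun M => RectClosed M) = ∅ := by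
  rw [filter_eq_empty_iff]
  intro M hM hR
  have := (fam_mem_of_rect hM hR).1
  exact hd ⟨(colFam M).card, by omega⟩

end RectCount

/-! ### The number of core arrays in closed form -/

theorem numDerangements_eq (d : ℕ) :
    (numDerangements d : ℚ) = d ! * ∑ i ∈ range (d + 1), (-1) ^ i / (i ! : ℚ) := by
  have h := congrArg (Int.cast : ℤ → ℚ) (numDerangements_sum d)
  push_cast at h
  rw [h, mul_sum]
  refine sum_congr rfl fun i hi => ?_
  have hle : i ≤ d := Nat.lt_succ_iff.1 (mem_range.1 hi)
  have := congrArg (Nat.cast : ℕ → ℚ) (Nat.factorial_mul_ascFactorial i (d - i))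
  rw [Nat.add_sub_cancel' hle] at this
  push_cast at this
  have h0 : (i ! : ℚ) ≠ 0 := by positivity
  rw [← this]
  field_simp

theorem descFactorial_eq {m d : ℕ} (h : d ≤ m) :
    (m.descFactorial d : ℚ) = (m ! : ℚ) / ((m - d)! : ℕ) := by
  have h0 : (((m - d)! : ℕ) : ℚ) ≠ 0 := by positivity
  rw [eq_div_iff h0, ← Nat.factorial_mul_descFactorial h]
  push_cast
  ring

/-- For odd `d` there are no `RectClosed` arrays, since four times the number of families' members
is `2d`. For `d = 2k` the correction is `k! * 512^k * (S^2 - R^2)`, and `S = s`, `R = s - (2/3) r`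
give `S^2 - R^2 = (4/3) s r - (4/9) r^2`. -/
theorem card_coreArrays {n d : ℕ} (hd : 2 ≤ d) (hdn : d ≤ 2 ^ (n - 1)) :
    ((coreArrays n d).card : ℚ) =
      (((2 ^ n - 1) * ((2 ^ (n - 1))! : ℕ) / ((2 ^ (n - 1) - d)! : ℕ)) ^ 2 * 2 ^ (4 * d) *
      ∑ i ∈ range (d + 1), (-1) ^ i / (i ! : ℚ)) - delta n d := by
  classical
  have hn : 2 ≤ n := by
    by_contra h
    have : n - 1 = 0 := by omega
    rw [this] at hdn
    omega
  have h := congrArg (Nat.cast : ℕ → ℚ) (card_core_add (n := n) d)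
  have h1 : (1 : ℕ) ≤ 2 ^ n := Nat.one_le_two_pow
  have hN : (2 : ℕ) ^ n = 2 * 2 ^ (n - 1) := by
    rw [← pow_succ', Nat.sub_add_cancel (by omega)]
  have h2 : (2 : ℕ) ≤ 2 ^ n := by
    have : 1 ≤ 2 ^ (n - 1) := Nat.one_le_two_pow
    omega
  have hmain : (((2 ^ n - 1) ^ 2 * (2 ^ (4 * d) * ((2 ^ (n - 1)).choose d *
        ((2 ^ (n - 1)).descFactorial d * numDerangements d))) : ℕ) : ℚ) =
      ((2 ^ n - 1) * ((2 ^ (n - 1))! : ℕ) / ((2 ^ (n - 1) - d)! : ℕ)) ^ 2 * 2 ^ (4 * d) *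
      ∑ i ∈ range (d + 1), (-1) ^ i / (i ! : ℚ) := by
    have hch := congrArg (Nat.cast : ℕ → ℚ) (Nat.descFactorial_eq_factorial_mul_choose
      (2 ^ (n - 1)) d)
    push_cast [Nat.cast_sub h1] at hch ⊢
    rw [numDerangements_eq]
    calc _ = (2 ^ n - 1 : ℚ) ^ 2 * 2 ^ (4 * d) * ((d ! : ℚ) * ((2 ^ (n - 1)).choose d : ℚ)) *
          ((2 ^ (n - 1)).descFactorial d : ℚ) *
          ∑ i ∈ range (d + 1), (-1) ^ i / (i ! : ℚ) := by ring
      _ = _ := by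
        rw [← hch, descFactorial_eq hdn]
        ring
  rw [Nat.cast_add, Nat.cast_add, hmain] at h
  by_cases he : Even d
  · obtain ⟨k, hk⟩ := he
    have hk2 : d = 2 * k := by omega
    have hk0 : 0 < k := by omega
    have hdk : d / 2 = k := by omega
    have e1 := sum_dirs_rect (n := n) k
    have e2 := card_core_rect (n := n) k
    rw [← hk2] at e1 e2
    rw [e1, e2] at h
    have hS := congrArg (Nat.cast : ℕ → ℚ) (sum_card_dirs (n := n) k)
    have hF := congrArg (Nat.cast : ℕ → ℚ) (sum_card_dirs_eq (n := n) hk0)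
    have h512 : (512 : ℚ) ^ k = 2 ^ (9 * k) := by rw [pow_mul]; norm_num
    set S : ℕ := ∑ 𝒜 ∈ fourFam n k, (dirs 𝒜).card
    set R := (dirFam n k).card
    have hs : (S : ℚ) = sNum n d := by
      have h3 : ((2 : ℚ) ^ k * (k ! : ℚ)) ≠ 0 := by positivity
      push_cast [Nat.cast_sub h1] at hS
      rw [← hk2, descFactorial_eq hdn] at hS
      rw [eq_div_of_mul_eq h3 hS, sNum, hdk]
      have h4 : (((2 ^ (n - 1) - d)! : ℕ) : ℚ) ≠ 0 := by positivity
      have h5 : (k ! : ℚ) ≠ 0 := by positivity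
      field_simp
    have hr : (R : ℚ) = sNum n d - 2 / 3 * rNum n d := by
      push_cast [Nat.cast_sub h1, Nat.cast_sub h2] at hF
      have hN' : (2 : ℚ) ^ n = 2 * 2 ^ (n - 1) := by exact_mod_cast hN
      have : rNum n d * 2 = (2 ^ n - 1) * (2 ^ n - 2) * (((2 ^ (n - 2)).choose k : ℕ) : ℚ) := by
        rw [rNum, hdk]
        have : (2 : ℚ) ^ n - 2 = 2 * (2 ^ (n - 1) - 1) := by rw [hN']; ring
        rw [this]
        ring
      rw [← this] at hF
      linarith
    have hdelta : delta n d = (k ! : ℚ) * 2 ^ (9 * k) *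
        (4 / 3 * sNum n d * rNum n d - 4 / 9 * rNum n d ^ 2) := by
      rw [delta, if_pos ⟨k, hk⟩, hdk]
    push_cast at h
    rw [hdelta]
    rw [hs, hr, h512] at h
    linear_combination h
  · have e1 := rect_filter_eq_empty (n := n) he
    have e2 : (coreArrays n d).filter (fun M => RectClosed M) = ∅ := by
      rw [coreArrays, filter_comm, e1, filter_empty]
    rw [e1, e2, sum_empty, card_empty] at h
    rw [delta, if_neg he]
    simpa using h

/-! ### The outputs of the algorithm as pairs of sign arrays -/

section Outputs
variable {n d : ℕ}

/-- The matrix with the entries `±2^(n-1)` given by `M` and the entries `±2^n` given by `G`. -/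
def combine (M G : V n → V n → SignType) : Matrix (V n) (V n) ℤ :=
  fun a b => 2 ^ (n - 1) * (M a b : ℤ) + 2 ^ n * (G a b : ℤ)

/-- In characteristic two the sum of a pair is its difference: it is nonzero, and translation by it
swaps the pair. Equal sums thus mean a common direction. -/
theorem IsPairFamily.exists_direction {I : Fin d → Finset (V n)} (hI : IsPairFamily I)
    (hd : 0 < d) : ∃ s, s ≠ 0 ∧ ∀ i, Inv s (I i) := by
  obtain ⟨h2, -, hs⟩ := hI
  refine ⟨∑ a ∈ I ⟨0, hd⟩, a, ?_, fun i a ha => ?_⟩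
  · obtain ⟨x, y, hxy, h⟩ := card_eq_two.1 (h2 ⟨0, hd⟩)
    rw [h, sum_pair hxy]
    intro h0
    rw [add_eq_iff_vec, zero_add] at h0
    exact hxy h0
  · rw [hs _ i]
    obtain ⟨x, y, hxy, h⟩ := card_eq_two.1 (h2 i)
    rw [h] at ha ⊢
    rw [sum_pair hxy]
    rcases mem_insert.1 ha with rfl | ha
    · rw [← add_assoc, add_self_vec, zero_add]; simp
    · rw [mem_singleton.1 ha, add_comm, add_add_self_vec]; simp

theorem mem_union_iff {I : Fin d → Finset (V n)} {a : V n} : a ∈ union I ↔ ∃ i, a ∈ I i := by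
  simp [union]

theorem IsPairFamily.card_union {I : Fin d → Finset (V n)} (hI : IsPairFamily I) :
    (union I).card = 2 * d := by
  rw [union, card_biUnion fun i _ j _ h => hI.2.1 i j h, sum_const_nat fun i _ => hI.1 i,
    card_univ, Fintype.card_fin, mul_comm]

theorem IsPairFamily.index_unique {I : Fin d → Finset (V n)} (hI : IsPairFamily I) {i j : Fin d}
    {a : V n} (hi : a ∈ I i) (hj : a ∈ I j) : i = j := by
  by_contra h
  exact disjoint_left.1 (hI.2.1 i j h) hi hj

/-- The orbits `{a, a + s}` partition `U`, and each has sum `s`. -/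
theorem exists_pairFamily {U : Finset (V n)} {s : V n} (hs : s ≠ 0) (hU : Inv s U)
    (hc : U.card = 2 * d) :
    ∃ I : Fin d → Finset (V n), IsPairFamily I ∧ union I = U ∧
      ∀ i, ∀ a ∈ I i, I i = {a, a + s} := by
  let f : V n → Finset (V n) := fun a => {a, a + s}
  have hne : ∀ a : V n, a ≠ a + s := fun a => by simpa using hs
  have hf2 : ∀ a, (f a).card = 2 := fun a => card_pair (hne a)
  have hmem : ∀ a b, b ∈ f a → f a = f b := by
    intro a b hb
    rcases mem_insert.1 hb with rfl | hb
    · rfl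
    · rw [mem_singleton.1 hb]
      show ({a, a + s} : Finset (V n)) = {a + s, a + s + s}
      rw [add_add_self_vec, pair_comm]
  have hdis : ∀ A ∈ U.image f, ∀ B ∈ U.image f, A ≠ B → Disjoint A B := by
    intro A hA B hB hAB
    obtain ⟨a, -, rfl⟩ := mem_image.1 hA
    obtain ⟨b, -, rfl⟩ := mem_image.1 hB
    rw [disjoint_left]
    intro x hx hx'
    exact hAB ((hmem _ _ hx).trans (hmem _ _ hx').symm)
  have hun : (U.image f).biUnion id = U := by
    ext a
    simp only [mem_biUnion, mem_image, id]
    constructor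
    · rintro ⟨_, ⟨b, hb, rfl⟩, ha⟩
      rcases mem_insert.1 ha with rfl | ha
      · exact hb
      · rw [mem_singleton.1 ha]; exact hU b hb
    · exact fun ha => ⟨_, ⟨a, ha, rfl⟩, mem_insert_self _ _⟩
  have hcard : (U.image f).card = d := by
    have := congrArg Finset.card hun
    rw [card_biUnion (t := id) fun A hA B hB h => hdis A hA B hB h,
      sum_const_nat (m := 2), hc] at this
    · omega
    · intro A hA
      obtain ⟨a, -, rfl⟩ := mem_image.1 hA
      exact hf2 a
  let e := (Finset.equivFinOfCardEq hcard).symm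
  have hex : ∀ i, ∃ a, f a = e i := fun i => by
    obtain ⟨a, -, h⟩ := mem_image.1 (e i).2
    exact ⟨a, h⟩
  have hpair : ∀ i, ∀ a ∈ (e i : Finset (V n)), (e i : Finset (V n)) = f a := by
    intro i a ha
    obtain ⟨b, hb⟩ := hex i
    rw [← hb] at ha ⊢
    exact hmem b a ha
  have hsum : ∀ i, ∑ a ∈ (e i : Finset (V n)), a = s := by
    intro i
    obtain ⟨a, ha⟩ := hex i
    rw [← ha]
    show ∑ x ∈ ({a, a + s} : Finset (V n)), x = s
    rw [sum_pair (hne a), ← add_assoc, add_self_vec, zero_add]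
  refine ⟨fun i => e i, ⟨fun i => ?_, fun i j hij => ?_, fun i j => by rw [hsum, hsum]⟩, ?_,
    fun i a ha => hpair i a ha⟩
  · obtain ⟨a, ha⟩ := hex i
    show (e i : Finset (V n)).card = 2
    rw [← ha]
    exact hf2 a
  · exact hdis _ (e i).2 _ (e j).2 fun h => hij (e.injective (Subtype.ext h))
  · refine Eq.trans ?_ hun
    ext a
    rw [mem_union_iff, mem_biUnion]
    constructor
    · rintro ⟨i, hi⟩
      exact ⟨_, (e i).2, hi⟩
    · rintro ⟨A, hA, ha⟩
      exact ⟨e.symm ⟨A, hA⟩, by simpa using ha⟩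

/-- The signs of the entries of `M` in the rows `R` and the columns `C`. -/
noncomputable def signOn (R C : Finset (V n)) (M : Matrix (V n) (V n) ℤ) : V n → V n → SignType :=
  fun a b => if a ∈ R ∧ b ∈ C then SignType.sign (M a b) else 0

theorem IsTwoRegular.transpose {T : Matrix (Fin d) (Fin d) ℕ} (h : IsTwoRegular T) :
    IsTwoRegular T.transpose := ⟨fun i j => h.1 j i, h.2.2, h.2.1⟩

theorem IsSignPattern.transpose {I J : Fin d → Finset (V n)} {T : Matrix (Fin d) (Fin d) ℕ}
    {M : Matrix (V n) (V n) ℤ} (h : IsSignPattern I J T M) :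
    IsSignPattern J I T.transpose M.transpose :=
  ⟨fun i j a ha b hb => h.1 j i b hb a ha, h.2.2, h.2.1⟩

theorem signOn_ne_zero_iff {I J : Fin d → Finset (V n)} {T : Matrix (Fin d) (Fin d) ℕ}
    {M : Matrix (V n) (V n) ℤ} (hT : IsTwoRegular T) (h : IsSignPattern I J T M) {a b : V n} :
    signOn (union I) (union J) M a b ≠ 0 ↔ ∃ i j, a ∈ I i ∧ b ∈ J j ∧ T i j = 1 := by
  unfold signOn
  constructor
  · intro h0
    split_ifs at h0 with hab
    · obtain ⟨i, hi⟩ := mem_union_iff.1 hab.1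
      obtain ⟨j, hj⟩ := mem_union_iff.1 hab.2
      refine ⟨i, j, hi, hj, (hT.1 i j).resolve_left fun hz => ?_⟩
      rw [(h.1 i j a hi b hj).2 hz] at h0
      simp at h0
    · exact absurd rfl h0
  · rintro ⟨i, j, hi, hj, hij⟩
    rw [if_pos ⟨mem_union_iff.2 ⟨i, hi⟩, mem_union_iff.2 ⟨j, hj⟩⟩]
    rcases (h.1 i j a hi b hj).1 hij with h' | h' <;> simp [h']

theorem isLine_signOn {I J : Fin d → Finset (V n)} {T : Matrix (Fin d) (Fin d) ℕ}
    {M : Matrix (V n) (V n) ℤ} (hI : IsPairFamily I) (hJ : IsPairFamily J) (hT : IsTwoRegular T)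
    (h : IsSignPattern I J T M) (a : V n) :
    IsLine 4 (signOn (union I) (union J) M a) ∧
      (a ∈ union I → ∃ b, signOn (union I) (union J) M a b ≠ 0) := by
  by_cases ha : a ∈ union I
  · obtain ⟨i, hi⟩ := mem_union_iff.1 ha
    have hs : supp (signOn (union I) (union J) M a) =
        (univ.filter fun j => T i j = 1).biUnion J := by
      ext b
      rw [mem_supp, signOn_ne_zero_iff hT h]
      simp only [mem_biUnion, mem_filter, mem_univ, true_and]
      constructor
      · rintro ⟨i', j, hi', hj, hij⟩
        rw [hI.index_unique hi' hi] at hij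
        exact ⟨j, hij, hj⟩
      · rintro ⟨j, hij, hj⟩
        exact ⟨i, j, hi, hj, hij⟩
    have hs' : supp (signOn (union I) (union J) M a) =
        (union J).filter fun b => M a b ≠ 0 := by
      ext b
      simp [signOn, ha]
    have hc : (supp (signOn (union I) (union J) M a)).card = 4 := by
      rw [hs, card_biUnion fun i _ j _ h => hJ.2.1 i j h, sum_const_nat fun j _ => hJ.1 j, hT.2.1 i]
    refine ⟨Or.inr ⟨hc, ?_⟩, fun _ => ?_⟩
    · have hp := h.2.1 a ha
      rw [hs']
      -- The product condition is over the integers; the multiplicative sign map carries it to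
      -- `SignType`.
      have := congrArg signHom hp
      rw [map_prod] at this
      refine Eq.trans (prod_congr rfl fun b hb => ?_) (this.trans (by simp [signHom]))
      simp [signOn, ha, (mem_filter.1 hb).1, signHom]
    · obtain ⟨b, hb⟩ : (supp (signOn (union I) (union J) M a)).Nonempty :=
        card_pos.1 (by rw [hc]; norm_num)
      exact ⟨b, mem_supp.1 hb⟩
  · exact ⟨Or.inl (funext fun b => by simp [signOn, ha]), fun h => absurd h ha⟩

theorem rowInv_signOn {I J : Fin d → Finset (V n)} {T : Matrix (Fin d) (Fin d) ℕ}
    {M : Matrix (V n) (V n) ℤ} (hT : IsTwoRegular T) (h : IsSignPattern I J T M) {s : V n}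
    (hs : ∀ i, Inv s (I i)) : RowInv s (signOn (union I) (union J) M) := by
  intro a b
  rw [← not_iff_not, ← Ne, ← Ne, signOn_ne_zero_iff hT h, signOn_ne_zero_iff hT h]
  exact ⟨fun ⟨i, j, hi, h⟩ => ⟨i, j, (hs i).mem_iff.1 hi, h⟩,
    fun ⟨i, j, hi, h⟩ => ⟨i, j, hs i a hi, h⟩⟩

theorem signOn_transpose (R C : Finset (V n)) (M : Matrix (V n) (V n) ℤ) :
    (fun b a => signOn R C M a b) = signOn C R M.transpose := by
  funext b a
  simp only [signOn, Matrix.transpose_apply, and_comm]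

theorem signOn_mem_core {I J : Fin d → Finset (V n)} {T : Matrix (Fin d) (Fin d) ℕ}
    {M : Matrix (V n) (V n) ℤ} (hd : 0 < d) (hI : IsPairFamily I) (hJ : IsPairFamily J)
    (hT : IsTwoRegular T) (h : IsSignPattern I J T M) :
    signOn (union I) (union J) M ∈ coreArrays n d ∧
      rowSet (signOn (union I) (union J) M) = union I ∧
      (rowSet fun b a => signOn (union I) (union J) M a b) = union J := by
  have hrow : ∀ {I J : Fin d → Finset (V n)} {T : Matrix (Fin d) (Fin d) ℕ}
      {M : Matrix (V n) (V n) ℤ}, IsPairFamily I → IsPairFamily J → IsTwoRegular T →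
      IsSignPattern I J T M → rowSet (signOn (union I) (union J) M) = union I := by
    intro I J T M hI hJ hT h
    ext a
    rw [mem_rowSet]
    refine ⟨?_, (isLine_signOn hI hJ hT h a).2⟩
    rintro ⟨b, hb⟩
    by_contra ha
    simp [signOn, ha] at hb
  have h1 := hrow hI hJ hT h
  have h2 := hrow hJ hI hT.transpose h.transpose
  refine ⟨?_, h1, by rw [signOn_transpose, h2]⟩
  obtain ⟨s, hs0, hs⟩ := hI.exists_direction hd
  obtain ⟨t, ht0, ht⟩ := hJ.exists_direction hd
  rw [coreArrays, mem_filter, mem_baseArrays, h1, hI.card_union]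
  refine ⟨⟨⟨fun a => (isLine_signOn hI hJ hT h a).1, fun b => ?_⟩, rfl⟩,
    ⟨s, mem_rowDirs.2 ⟨hs0, rowInv_signOn hT h hs⟩⟩, ⟨t, mem_colDirs.2 ⟨ht0, ?_⟩⟩⟩
  · have := (isLine_signOn hJ hI hT.transpose h.transpose b).1
    rwa [← signOn_transpose] at this
  · rw [signOn_transpose]
    exact rowInv_signOn hT.transpose h.transpose ht

/-- The choices of `I`, `J` and `T` survive only as the existence of directions of the support. -/
theorem exists_combine_of_mem {F : Matrix (V n) (V n) ℤ} (hd : 0 < d)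
    (hF : F ∈ algorithmOutputs n d) :
    ∃ M ∈ coreArrays n d, ∃ G, IsMonomial (rowSet M)ᶜ (rowSet fun b a => M a b)ᶜ G ∧
      combine M G = F := by
  obtain ⟨I, J, T, M, hI, hJ, hT, hM, h1, ⟨h2, h3, h4⟩, h5⟩ := hF
  obtain ⟨hc, hR, hC⟩ := signOn_mem_core hd hI hJ hT hM
  refine ⟨_, hc, signOn (union I)ᶜ (union J)ᶜ F, ?_, ?_⟩
  · rw [hR, hC]
    refine ⟨fun a b hab => ?_, fun a ha => ?_, fun b hb => ?_⟩
    · by_contra h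
      exact hab (if_neg h)
    · have := h3 a (mem_compl.1 ha)
      simpa [signOn, mem_compl.1 ha, imp_iff_not_or, ite_eq_iff] using this
    · have := h4 b (mem_compl.1 hb)
      simpa [signOn, mem_compl.1 hb, imp_iff_not_or, ite_eq_iff] using this
  · funext a b
    simp only [combine, signOn, mem_compl]
    by_cases ha : a ∈ union I <;> by_cases hb : b ∈ union J
    · rw [h1 a ha b hb]
      obtain ⟨i, hi⟩ := mem_union_iff.1 ha
      obtain ⟨j, hj⟩ := mem_union_iff.1 hb
      have hv : M a b = 0 ∨ M a b = 1 ∨ M a b = -1 := (hT.1 i j).elim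
        (fun h0 => Or.inl ((hM.1 i j a hi b hj).2 h0)) (fun h0 => Or.inr ((hM.1 i j a hi b hj).1 h0))
      rcases hv with h | h | h <;> simp [ha, hb, h]
    · rw [h5 a b (Or.inl ⟨ha, hb⟩)]; simp [ha, hb]
    · rw [h5 a b (Or.inr ⟨ha, hb⟩)]; simp [ha, hb]
    · have hp : (0 : ℤ) < 2 ^ n := by positivity
      have hs : SignType.sign ((2 : ℤ) ^ n) = 1 := sign_pos hp
      have hs' : SignType.sign (-(2 : ℤ) ^ n) = -1 := sign_neg (by omega)
      rcases h2 a ha b hb with h | h | h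
      · simp [ha, hb, h]
      · simp [ha, hb, h, hs]
      · rw [h]; simp only [ha, hb, not_false_eq_true, and_self, if_true, hs', if_false]; simp

theorem signType_cast_eq_zero {x : SignType} : (x : ℤ) = 0 ↔ x = 0 := by
  cases x <;> decide

theorem rowInv_ne_iff {M : V n → V n → SignType} {s a b : V n} {A : Finset (V n)}
    (hs : RowInv s M) (hA : ∀ x ∈ A, A = {x, x + s}) {a' : V n} (ha : a ∈ A) (ha' : a' ∈ A) :
    M a b ≠ 0 ↔ M a' b ≠ 0 := by
  have := hA a ha
  rw [this] at ha'
  rcases mem_insert.1 ha' with rfl | ha'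
  · rfl
  · rw [mem_singleton.1 ha', Ne, Ne, hs a b]

/-- By invariance the four nonzero elements of a row fill whole pairs `J j`, so there are two such
pairs, the same for both rows of `I i`. -/
theorem card_blocks_eq_two {M : V n → V n → SignType} (hM : ∀ a, IsLine 4 (M a))
    {I J : Fin d → Finset (V n)} (hI : IsPairFamily I) (hJ : IsPairFamily J)
    (hR : rowSet M = union I) (hC : (rowSet fun b a => M a b) = union J) {s t : V n}
    (hs : RowInv s M) (ht : RowInv t fun b a => M a b)
    (hIs : ∀ i, ∀ a ∈ I i, I i = {a, a + s}) (hJt : ∀ i, ∀ a ∈ J i, J i = {a, a + t}) (i : Fin d)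
    [DecidablePred fun j => ∃ a ∈ I i, ∃ b ∈ J j, M a b ≠ 0] :
    (univ.filter fun j => ∃ a ∈ I i, ∃ b ∈ J j, M a b ≠ 0).card = 2 := by
  obtain ⟨a, ha⟩ : (I i).Nonempty := card_pos.1 (by rw [hI.1]; norm_num)
  have har : a ∈ rowSet M := by rw [hR]; exact mem_union_iff.2 ⟨i, ha⟩
  obtain ⟨c, hc⟩ := mem_rowSet.1 har
  have h4 := (hM a).card_supp hc
  have hs : supp (M a) = (univ.filter fun j => ∃ a ∈ I i, ∃ b ∈ J j, M a b ≠ 0).biUnion J := by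
    ext b
    simp only [mem_supp, mem_biUnion, mem_filter, mem_univ, true_and]
    constructor
    · intro hab
      have : b ∈ union J := by rw [← hC]; exact mem_rowSet.2 ⟨a, hab⟩
      obtain ⟨j, hj⟩ := mem_union_iff.1 this
      exact ⟨j, ⟨a, ha, b, hj, hab⟩, hj⟩
    · rintro ⟨j, ⟨a', ha', b', hb', hab⟩, hb⟩
      rw [rowInv_ne_iff hs (hIs i) ha' ha] at hab
      exact (rowInv_ne_iff (M := fun b a => M a b) ht (hJt j) hb' hb).1 hab
  rw [hs, card_biUnion fun i _ j _ h => hJ.2.1 i j h, sum_const_nat fun j _ => hJ.1 j] at h4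
  omega

theorem signType_cast_prod {ι : Type*} (s : Finset ι) (f : ι → SignType) :
    ((∏ i ∈ s, f i : SignType) : ℤ) = ∏ i ∈ s, (f i : ℤ) :=
  map_prod (SignType.castHom (α := ℤ)) f s

theorem prod_cast_row {M : V n → V n → SignType} (hM : ∀ a, IsLine 4 (M a)) {C : Finset (V n)}
    (hC : (rowSet fun b a => M a b) = C) {a : V n} (ha : a ∈ rowSet M) :
    ∏ b ∈ C.filter (fun b => (M a b : ℤ) ≠ 0), (M a b : ℤ) = -1 := by
  obtain ⟨c, hc⟩ := mem_rowSet.1 ha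
  have h := (hM a).prod_supp hc
  have hs : C.filter (fun b => (M a b : ℤ) ≠ 0) = supp (M a) := by
    ext b
    rw [mem_filter, mem_supp, Ne, signType_cast_eq_zero, ← hC, mem_rowSet]
    exact ⟨fun h => h.2, fun h => ⟨⟨a, h⟩, h⟩⟩
  rw [hs, ← signType_cast_prod, h]
  rfl

/-- Any row direction and any column direction of `M` serve: their orbits are the pairs of step 1,
and `T` marks the nonzero blocks. -/
theorem combine_mem_outputs {M G : V n → V n → SignType} (hM : M ∈ coreArrays n d)
    (hG : IsMonomial (rowSet M)ᶜ (rowSet fun b a => M a b)ᶜ G) :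
    combine M G ∈ algorithmOutputs n d := by
  classical
  obtain ⟨hB, ⟨s, hs⟩, ⟨t, ht⟩⟩ := mem_filter.1 hM
  obtain ⟨hM4, hMd⟩ := mem_baseArrays.1 hB
  obtain ⟨hs0, hs⟩ := mem_rowDirs.1 hs
  obtain ⟨ht0, ht⟩ := mem_colDirs.1 ht
  have hinv : ∀ {M : V n → V n → SignType} {s : V n}, RowInv s M → Inv s (rowSet M) := by
    intro M s hs a ha
    obtain ⟨b, hb⟩ := mem_rowSet.1 ha
    exact mem_rowSet.2 ⟨b, by rwa [Ne, hs a b]⟩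
  obtain ⟨I, hI, hIU, hIs⟩ := exists_pairFamily hs0 (hinv hs) hMd
  obtain ⟨J, hJ, hJU, hJt⟩ := exists_pairFamily ht0 (hinv ht)
    ((card_rowSet_transpose (by norm_num) hM4).trans hMd)
  have hrow0 : ∀ a b, a ∉ rowSet M → M a b = 0 := by
    intro a b ha
    by_contra h
    exact ha (mem_rowSet.2 ⟨b, h⟩)
  have hcol0 : ∀ a b, b ∉ (rowSet fun b a => M a b) → M a b = 0 := by
    intro a b hb
    by_contra h
    exact hb (mem_rowSet.2 ⟨a, h⟩)
  have hG0 : ∀ a b, a ∈ rowSet M ∨ b ∈ (rowSet fun b a => M a b) → G a b = 0 := by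
    intro a b hab
    by_contra h
    obtain ⟨h1, h2⟩ := hG.1 a b h
    exact hab.elim (mem_compl.1 h1) (mem_compl.1 h2)
  have hout : ∀ a b, a ∉ rowSet M → combine M G a b = 2 ^ n * (G a b : ℤ) := by
    intro a b ha
    simp [combine, hrow0 a b ha]
  have hne : ∀ a b, a ∉ rowSet M → (combine M G a b ≠ 0 ↔ G a b ≠ 0) := by
    intro a b ha
    rw [hout a b ha, mul_ne_zero_iff, Ne, Ne, signType_cast_eq_zero]
    simp
  refine ⟨I, J, fun i j => if ∃ a ∈ I i, ∃ b ∈ J j, M a b ≠ 0 then 1 else 0,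
    fun a b => (M a b : ℤ), hI, hJ, ⟨fun i j => ?_, fun i => ?_, fun j => ?_⟩,
    ⟨fun i j a ha b hb => ⟨fun h => ?_, fun h => ?_⟩, fun a ha => ?_, fun b hb => ?_⟩, ?_,
    ⟨?_, ?_, ?_⟩, ?_⟩
  · by_cases h : ∃ a ∈ I i, ∃ b ∈ J j, M a b ≠ 0 <;> simp [h]
  · rw [← card_blocks_eq_two hM4.1 hI hJ hIU.symm hJU.symm hs ht hIs hJt i]
    congr 1
    ext j
    simp
  · rw [← card_blocks_eq_two (M := fun b a => M a b) hM4.2 hJ hI hJU.symm hIU.symm ht hs hJt hIs j]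
    congr 1
    ext i
    simp only [mem_filter, mem_univ, true_and]
    constructor
    · intro h
      by_contra h'
      rw [if_neg] at h
      · exact absurd h (by norm_num)
      · rintro ⟨a, ha, b, hb, hab⟩
        exact h' ⟨b, hb, a, ha, hab⟩
    · rintro ⟨b, hb, a, ha, hab⟩
      exact if_pos ⟨a, ha, b, hb, hab⟩
  · have hex : ∃ a ∈ I i, ∃ b ∈ J j, M a b ≠ 0 := by
      by_contra h'
      simp [h'] at h
    obtain ⟨a', ha', b', hb', hab⟩ := hex
    rw [rowInv_ne_iff hs (hIs i) ha' ha] at hab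
    have := (rowInv_ne_iff (M := fun b a => M a b) ht (hJt j) hb' hb).1 hab
    rcases signType_eq_one_or this with h | h <;> simp [h]
  · rw [signType_cast_eq_zero]
    by_contra h'
    simp only at h
    rw [if_pos ⟨a, ha, b, hb, h'⟩] at h
    exact absurd h (by norm_num)
  · rw [hIU] at ha
    exact prod_cast_row hM4.1 hJU.symm ha
  · rw [hJU] at hb
    exact prod_cast_row (M := fun b a => M a b) hM4.2 hIU.symm hb
  · intro a ha b hb
    rw [hIU] at ha
    simp [combine, hG0 a b (Or.inl ha)]
  · intro a ha b hb
    rw [hIU] at ha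
    rw [hout a b ha]
    rcases SignType.trichotomy (G a b) with h | h | h <;> simp [h]
  · intro a ha
    rw [hIU] at ha
    obtain ⟨b, hb, hu⟩ := hG.2.1 a (mem_compl.2 ha)
    simp only [hJU, hne a _ ha]
    exact ⟨b, ⟨mem_compl.1 (hG.1 a b hb).2, hb⟩, fun y hy => hu y hy.2⟩
  · intro b hb
    rw [hJU] at hb
    obtain ⟨a, ha, hu⟩ := hG.2.2 b (mem_compl.2 hb)
    have har := mem_compl.1 (hG.1 a b ha).1
    rw [hIU]
    exact ⟨a, ⟨har, (hne a b har).2 ha⟩, fun y hy => hu y ((hne y b hy.1).1 hy.2)⟩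
  · rw [hIU, hJU]
    rintro a b (⟨ha, hb⟩ | ⟨ha, hb⟩)
    · simp [combine, hG0 a b (Or.inl ha), hcol0 a b hb]
    · simp [combine, hG0 a b (Or.inr hb), hrow0 a b ha]

/-- If one of two signs `x`, `y` is zero, then `x + 2y` determines both. -/
theorem combine_injective {M G M' G' : V n → V n → SignType} (hn : 0 < n)
    (h : ∀ a b, M a b = 0 ∨ G a b = 0) (h' : ∀ a b, M' a b = 0 ∨ G' a b = 0)
    (he : combine M G = combine M' G') : M = M' ∧ G = G' := by
  have key : ∀ x y x' y' : SignType, (x = 0 ∨ y = 0) → (x' = 0 ∨ y' = 0) →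
      (x : ℤ) + 2 * (y : ℤ) = x' + 2 * y' → x = x' ∧ y = y' := by decide
  have hp : (2 : ℤ) ^ n = 2 ^ (n - 1) * 2 := by rw [← pow_succ, Nat.sub_add_cancel hn]
  have hab : ∀ a b, M a b = M' a b ∧ G a b = G' a b := by
    intro a b
    refine key _ _ _ _ (h a b) (h' a b) ?_
    have := congrFun₂ he a b
    simp only [combine, hp] at this
    have h2 : (2 : ℤ) ^ (n - 1) ≠ 0 := by positivity
    apply mul_left_cancel₀ h2
    linear_combination this
  exact ⟨funext₂ fun a b => (hab a b).1, funext₂ fun a b => (hab a b).2⟩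

/-- The number of monomial arrays depends only on the number `2^n - 2d` of remaining rows and
columns, not on `M`. -/
theorem ncard_outputs (hd : 0 < d) (hn : 0 < n) :
    (algorithmOutputs n d).ncard =
      (coreArrays n d).card * ((2 ^ n - 2 * d)! * 2 ^ (2 ^ n - 2 * d)) := by
  classical
  let P : Finset (Σ _ : V n → V n → SignType, V n → V n → SignType) :=
    (coreArrays n d).sigma fun M =>
      univ.filter (IsMonomial (rowSet M)ᶜ (rowSet fun b a => M a b)ᶜ)
  have hP : algorithmOutputs n d = (P.image fun p => combine p.1 p.2 : Finset _) := by
    ext F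
    simp only [P, coe_image, Set.mem_image, mem_coe, mem_sigma, mem_filter, mem_univ, true_and]
    constructor
    · intro hF
      obtain ⟨M, hM, G, hG, rfl⟩ := exists_combine_of_mem hd hF
      exact ⟨⟨M, G⟩, ⟨hM, hG⟩, rfl⟩
    · rintro ⟨⟨M, G⟩, ⟨hM, hG⟩, rfl⟩
      exact combine_mem_outputs hM hG
  rw [hP, Set.ncard_coe_finset, card_image_of_injOn, card_sigma, sum_const_nat]
  · intro M hM
    obtain ⟨hM4, hMd⟩ := mem_baseArrays.1 (mem_filter.1 hM).1
    have hV : Fintype.card (V n) = 2 ^ n := by simp [V]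
    have h1 : ((rowSet M)ᶜ).card = 2 ^ n - 2 * d := by rw [card_compl, hMd, hV]
    have h2 : ((rowSet fun b a => M a b)ᶜ).card = 2 ^ n - 2 * d := by
      rw [card_compl, card_rowSet_transpose (by norm_num) hM4, hMd, hV]
    rw [card_monomial (h1.trans h2.symm), h1]
  · have hz : ∀ p ∈ P, ∀ a b, p.1 a b = 0 ∨ p.2 a b = 0 := by
      rintro ⟨M, G⟩ hp a b
      have hG := (mem_filter.1 (mem_sigma.1 hp).2).2
      by_contra h
      push Not at h
      exact mem_compl.1 (hG.1 a b h.2).1 (mem_rowSet.2 ⟨b, h.1⟩)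
    rintro ⟨M, G⟩ hp ⟨M', G'⟩ hp' he
    obtain ⟨h1, h2⟩ := combine_injective hn (hz _ hp) (hz _ hp') he
    simp only at h1 h2
    subst h1 h2
    rfl

end Outputs

/-! ### The outputs of the algorithm are bent squares -/

section Walsh
variable {n : ℕ}

theorem sgn_add (x y : ZMod 2) : sgn (x + y) = sgn x * sgn y := by
  revert x y; decide

theorem ip_add_left (a b x : V n) : ip (a + b) x = ip a x + ip b x := by
  simp [ip, add_mul, sum_add_distrib]

theorem ip_add_right (a x y : V n) : ip a (x + y) = ip a x + ip a y := by
  simp [ip, mul_add, sum_add_distrib]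

theorem sum_sgn_ip (a : V n) : ∑ x : V n, sgn (ip a x) = if a = 0 then 2 ^ n else 0 := by
  split_ifs with h
  · subst h
    have : ∀ x : V n, sgn (ip 0 x) = 1 := fun x => by simp [ip, sgn]
    simp [this, V]
  · obtain ⟨i, hi⟩ := Function.ne_iff.1 h
    have hi : a i = 1 := Fin.eq_one_of_ne_zero _ hi
    have he : ip a (Pi.single i 1) = 1 := by simp [ip, Pi.single_apply, hi]
    -- Shifting by the `i`-th unit vector, where `a i = 1`, changes the sign of every term, so the
    -- sum equals its own negative.
    have := Fintype.sum_equiv (Equiv.addRight (Pi.single i 1 : V n))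
      (fun x => sgn (ip a (x + Pi.single i 1))) (fun x => sgn (ip a x)) (fun x => by rw [Equiv.coe_addRight])
    simp only [ip_add_right, he, sgn_add, ← sum_mul] at this
    have h1 : sgn 1 = -1 := by decide
    rw [h1] at this
    linarith

/-- The inversion formula. -/
theorem walsh_eq_of_inverse {f : BoolFun n} {h : V n → ℤ}
    (hf : ∀ x, ∑ a, h a * sgn (ip a x) = 2 ^ n * sgn (f x)) : walsh f = h := by
  funext b
  have hp : (2 : ℤ) ^ n ≠ 0 := by positivity
  apply mul_left_cancel₀ hp
  have h1 : (2 : ℤ) ^ n * walsh f b = ∑ x, ∑ a, h a * sgn (ip (a + b) x) := by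
    rw [walsh, mul_sum]
    refine sum_congr rfl fun x _ => ?_
    rw [← mul_assoc, ← hf, sum_mul]
    refine sum_congr rfl fun a _ => ?_
    rw [ip_add_left, sgn_add, mul_assoc]
  rw [h1, sum_comm]
  simp only [← mul_sum, sum_sgn_ip]
  rw [sum_eq_single b]
  · rw [add_self_vec, if_pos rfl, mul_comm]
  · intro a _ hab
    rw [if_neg, mul_zero]
    intro h0
    rw [add_eq_iff_vec, zero_add] at h0
    exact hab h0
  · simp

theorem exists_affine {g : V n → SignType} {b : V n} (hb : g b ≠ 0) (hu : ∀ y, g y ≠ 0 → y = b) :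
    ∃ f ∈ affineFuns n, (fun x => 2 ^ n * (g x : ℤ)) = walsh f := by
  obtain ⟨c, hc⟩ : ∃ c : ZMod 2, (g b : ℤ) = sgn c := by
    rcases signType_eq_one_or hb with h | h
    · exact ⟨0, by rw [h]; rfl⟩
    · exact ⟨1, by rw [h]; rfl⟩
  refine ⟨fun x => ip b x + c, ⟨b, c, fun x => rfl⟩, (walsh_eq_of_inverse fun x => ?_).symm⟩
  rw [sum_eq_single b, hc, sgn_add]
  · ring
  · intro a _ hab
    have : g a = 0 := by
      by_contra h
      exact hab (hu a h)
    simp [this]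
  · simp

/-- Invariance makes the support `{b, b + t, c, c + t}`, whose elements sum to zero, so the four
characters multiply to 1. With coefficients of product `-1`, an odd number of the four terms are
`-1` at each point and their sum is `±2`. Inversion then yields a Boolean function. -/
theorem exists_quad {g : V n → SignType} (hn : 0 < n) (hg : IsLine 4 g) {b t : V n} (hb : g b ≠ 0)
    (ht0 : t ≠ 0) (ht : ∀ x, g (x + t) = 0 ↔ g x = 0) :
    ∃ f ∈ quadFuns n, (fun x => 2 ^ (n - 1) * (g x : ℤ)) = walsh f := by
  have hc := hg.card_supp hb
  have hp := hg.prod_supp hb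
  have h1 : b ≠ b + t := by simpa using ht0
  have hbt : g (b + t) ≠ 0 := by rwa [Ne, ht]
  obtain ⟨c, hc1, hc2⟩ : ∃ c ∈ supp g, c ∉ ({b, b + t} : Finset (V n)) := by
    by_contra h
    push Not at h
    have := card_le_card (show supp g ⊆ {b, b + t} from h)
    rw [hc, card_pair h1] at this
    omega
  simp only [mem_insert, mem_singleton, not_or] at hc2
  have hc0 := mem_supp.1 hc1
  have hct : g (c + t) ≠ 0 := by rwa [Ne, ht]
  have h2 : b ≠ c + t := fun h => hc2.2 (add_eq_iff_vec.1 h.symm)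
  have h3 : b + t ≠ c + t := fun h => hc2.1 (add_right_cancel h).symm
  have h4 : c ≠ c + t := by simpa using ht0
  have hs : supp g = {b, b + t, c, c + t} := by
    symm
    apply eq_of_subset_of_card_le
    · intro x hx
      simp only [mem_insert, mem_singleton] at hx
      rw [mem_supp]
      rcases hx with rfl | rfl | rfl | rfl <;> assumption
    · rw [hc]
      simp [h1, Ne.symm hc2.1, h2, Ne.symm hc2.2, h3, h4]
  have hS : ∀ ψ : V n → ℤ, ∑ x ∈ supp g, ψ x =
      ψ b + (ψ (b + t) + (ψ c + ψ (c + t))) := by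
    intro ψ
    rw [hs, sum_insert, sum_insert, sum_pair h4] <;>
      simp [h1, Ne.symm hc2.1, h2, Ne.symm hc2.2, h3, h4]
  have hp' : g b * (g (b + t) * (g c * g (c + t))) = -1 := by
    rw [← hp, hs, prod_insert, prod_insert, prod_pair h4] <;>
      simp [h1, Ne.symm hc2.1, h2, Ne.symm hc2.2, h3, h4]
  have key : ∀ p q r s : SignType, p * (q * (r * s)) = -1 → ∀ u v w : ZMod 2, ∃ z : ZMod 2,
      (p : ℤ) * sgn u + ((q : ℤ) * sgn (u + w) + ((r : ℤ) * sgn v + (s : ℤ) * sgn (v + w))) =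
        2 * sgn z := by
    decide
  choose f hf using fun x : V n => key _ _ _ _ hp' (ip b x) (ip c x) (ip t x)
  have hpow : (2 : ℤ) ^ n = 2 ^ (n - 1) * 2 := by rw [← pow_succ, Nat.sub_add_cancel hn]
  have hw : walsh f = fun x => 2 ^ (n - 1) * (g x : ℤ) := by
    refine walsh_eq_of_inverse fun x => ?_
    have h5 : ∑ a, 2 ^ (n - 1) * (g a : ℤ) * sgn (ip a x) =
        ∑ a ∈ supp g, 2 ^ (n - 1) * (g a : ℤ) * sgn (ip a x) := by
      symm
      apply sum_subset (subset_univ _)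
      intro a _ ha
      have : g a = 0 := by simpa using ha
      simp [this]
    rw [h5, hS, hpow, mul_assoc ((2 : ℤ) ^ (n - 1)) 2, ← hf x]
    simp only [ip_add_left]
    ring
  refine ⟨f, ?_, hw.symm⟩
  show (univ.filter fun a : V n => walsh f a ≠ 0).card = 4
  rw [← hc]
  congr 1
  ext a
  rw [hw]
  simp [signType_cast_eq_zero]

variable {d : ℕ}

theorem isMonomial_transpose {R C : Finset (V n)} {G : V n → V n → SignType}
    (h : IsMonomial R C G) : IsMonomial C R fun b a => G a b :=
  ⟨fun b a hab => (h.1 a b hab).symm, h.2.2, h.2.1⟩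

theorem coreArrays_transpose {M : V n → V n → SignType} (h : M ∈ coreArrays n d) :
    (fun b a => M a b) ∈ coreArrays n d := by
  obtain ⟨hB, hr, hc⟩ := mem_filter.1 h
  obtain ⟨hM, hd⟩ := mem_baseArrays.1 hB
  exact mem_filter.2 ⟨mem_baseArrays.2 ⟨hM.transpose,
    (card_rowSet_transpose (by norm_num) hM).trans hd⟩, hc, hr⟩

theorem combine_row_quad {M G : V n → V n → SignType} (hn : 0 < n) (hM : M ∈ coreArrays n d)
    (hG : IsMonomial (rowSet M)ᶜ (rowSet fun b a => M a b)ᶜ G) {a : V n} (ha : a ∈ rowSet M) :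
    ∃ f ∈ quadFuns n, combine M G a = walsh f := by
  obtain ⟨hB, -, ⟨t, ht⟩⟩ := mem_filter.1 hM
  obtain ⟨ht0, ht⟩ := mem_colDirs.1 ht
  obtain ⟨b, hb⟩ := mem_rowSet.1 ha
  obtain ⟨f, hf, h⟩ := exists_quad hn ((mem_baseArrays.1 hB).1.1 a) hb ht0 fun x => ht x a
  refine ⟨f, hf, ?_⟩
  rw [← h]
  funext x
  have : G a x = 0 := by
    by_contra h
    exact mem_compl.1 (hG.1 a x h).1 ha
  simp [combine, this]

theorem combine_row_affine {M G : V n → V n → SignType}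
    (hG : IsMonomial (rowSet M)ᶜ (rowSet fun b a => M a b)ᶜ G) {a : V n} (ha : a ∉ rowSet M) :
    ∃ b, (∀ x, combine M G a x ≠ 0 → x = b) ∧ ∃ f ∈ affineFuns n, combine M G a = walsh f := by
  obtain ⟨b, hb, hu⟩ := hG.2.1 a (mem_compl.2 ha)
  obtain ⟨f, hf, h⟩ := exists_affine hb hu
  have hc : combine M G a = fun x => 2 ^ n * (G a x : ℤ) := by
    funext x
    have : M a x = 0 := by
      by_contra h
      exact ha (mem_rowSet.2 ⟨x, h⟩)
    simp [combine, this]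
  refine ⟨b, fun x hx => hu x fun h => hx ?_, f, hf, by rw [hc, h]⟩
  simp [hc, h]

theorem combine_row {M G : V n → V n → SignType} (hn : 0 < n) (hM : M ∈ coreArrays n d)
    (hG : IsMonomial (rowSet M)ᶜ (rowSet fun b a => M a b)ᶜ G) (a : V n) :
    ∃ f ∈ affineFuns n ∪ quadFuns n, combine M G a = walsh f := by
  by_cases ha : a ∈ rowSet M
  · obtain ⟨f, hf, h⟩ := combine_row_quad hn hM hG ha
    exact ⟨f, Or.inr hf, h⟩
  · obtain ⟨-, -, f, hf, h⟩ := combine_row_affine hG ha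
    exact ⟨f, Or.inl hf, h⟩

/-- A row outside `rowSet M` has at most one nonzero entry, so it cannot have four nonzero
coefficients. -/
theorem quadRows_combine {M G : V n → V n → SignType} (hn : 0 < n) (hM : M ∈ coreArrays n d)
    (hG : IsMonomial (rowSet M)ᶜ (rowSet fun b a => M a b)ᶜ G) :
    quadRows (combine M G) = (rowSet M : Set (V n)) := by
  ext a
  constructor
  · rintro ⟨q, hq, h⟩
    by_contra ha
    obtain ⟨b, hb, -⟩ := combine_row_affine hG ha
    have hq' : (univ.filter fun x : V n => walsh q x ≠ 0).card = 4 := hq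
    have : (univ.filter fun x : V n => walsh q x ≠ 0) ⊆ {b} := by
      intro x hx
      rw [← h] at hx
      exact mem_singleton.2 (hb x (mem_filter.1 hx).2)
    have := card_le_card this
    rw [hq', card_singleton] at this
    omega
  · intro ha
    exact combine_row_quad hn hM hG ha

theorem outputs_subset (hd : 0 < d) (hn : 0 < n) :
    algorithmOutputs n d ⊆ bentSquaresAQCount n (2 * d) := by
  intro F hF
  obtain ⟨M, hM, G, hG, rfl⟩ := exists_combine_of_mem hd hF
  have h1 := combine_row hn hM hG
  -- Core and monomial arrays are stable under transposition, so columns are treated as rows.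
  have h2 : ∀ b, ∃ f ∈ affineFuns n ∪ quadFuns n, (fun a => combine M G a b) = walsh f := fun b =>
    combine_row hn (coreArrays_transpose hM) (isMonomial_transpose hG) b
  refine ⟨⟨⟨fun a => ?_, fun b => ?_⟩, h1, h2⟩, ?_⟩
  · obtain ⟨f, -, h⟩ := h1 a
    exact ⟨f, h⟩
  · obtain ⟨f, -, h⟩ := h2 b
    exact ⟨f, h⟩
  · rw [quadRows_combine hn hM hG, Set.ncard_coe_finset]
    exact (mem_baseArrays.1 (mem_filter.1 hM).1).2

/-- Finiteness is what makes `Set.ncard` monotone in the final inequality, as an infinite set has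
`ncard` zero. -/
theorem finite_bentSquaresAQCount (n k : ℕ) : (bentSquaresAQCount n k).Finite := by
  refine (Set.finite_range fun g : V n → BoolFun n => fun a => walsh (g a)).subset ?_
  rintro F ⟨⟨⟨h, -⟩, -⟩, -⟩
  choose g hg using h
  exact ⟨g, (funext hg).symm⟩

end Walsh
end BentSquares

theorem theorem2 (n d : ℕ) (hd : 2 ≤ d) (hdn : d ≤ 2 ^ (n - 1)) :
    BentSquares.algorithmOutputs n d ⊆ BentSquares.bentSquaresAQCount n (2 * d) ∧
    ((BentSquares.algorithmOutputs n d).ncard : ℚ) = BentSquares.outputCount n d ∧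
    BentSquares.outputCount n d ≤ ((BentSquares.bentSquaresAQCount n (2 * d)).ncard : ℚ) := by
  have hn : 0 < n := by
    rcases Nat.eq_zero_or_pos n with rfl | h
    · simp at hdn
      omega
    · exact h
  have h1 := BentSquares.outputs_subset (by omega : 0 < d) hn
  have h2 : ((BentSquares.algorithmOutputs n d).ncard : ℚ) = BentSquares.outputCount n d := by
    rw [BentSquares.ncard_outputs (by omega) hn, BentSquares.outputCount, Nat.cast_mul,
      BentSquares.card_coreArrays hd hdn]
    push_cast
    ring
  refine ⟨h1, h2, ?_⟩
  rw [← h2]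
  exact_mod_cast Set.ncard_le_ncard h1 (BentSquares.finite_bentSquaresAQCount n (2 * d))
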